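/- Let $s_1\ge 2$ and $s_2=s_1-1$. Let $(A,b,c)$ be the $s_1$-stage Lobatto IIIA method: $c_1<\dots<c_{s_1}$ are the zeros of $\frac{d^{s_1-2}}{dx^{s_1-2}}\bigl(x^{s_1-1}(x-1)^{s_1-1}\bigr)$, $\mathcal L_j(x)=\prod_{k\ne j}\frac{x-c_k}{c_j-c_k}$, $a_{i,j}=\int_0^{c_i}\mathcal L_j(\tau)\,d\tau$ and $b_j=\int_0^1\mathcal L_j(\tau)\,d\tau$. Let $(\tilde b,\tilde c)$ be the weights and nodes of the $s_2$-node Gauss--Legendre quadrature on $[0,1]$. Let $\tilde A=(\tilde a_{i,j})\in\mathbb R^{s_2\times s_1}$ be given either by interpolation, $\tilde a_{i,j}=\sum_{l=1}^{s_1}\mathcal L_l(\tilde c_i)\,a_{l,j}$, or by collocation, $\tilde a_{i,j}=\int_0^{\tilde c_i}\mathcal L_j(\tau)\,d\tau$. Put $$\hat a_{i,j}=b_j-\frac{b_j a_{j,i}}{b_i},\qquad \hat{\tilde a}_{i,k}=\tilde b_k-\frac{\tilde b_k\tilde a_{k,i}}{b_i},$$ so that $(A,\hat A)$ is the Lobatto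 IIIA--IIIB pair. For $F^1=-\nabla V^1$, $F^2=-\nabla V^2$ with smooth potentials $V^1,V^2:\mathbb R^d\to\mathbb R$, consider the system $\dot q=p$, $\dot p=F^1(q)+F^2(q)$ and the one-step method $(q_0,p_0)\mapsto(q_1,p_1)$ with step size $h$ given by $$P_i=p_0+h\sum_{j=1}^{s_1}\hat a_{i,j}F^1(Q_j)+h\sum_{k=1}^{s_2}\hat{\tilde a}_{i,k}F^2(\tilde Q_k),\quad Q_i=q_0+h\sum_{j=1}^{s_1}a_{i,j}P_j,\quad \tilde Q_k=q_0+h\sum_{j=1}^{s_1}\tilde a_{k,j}P_j,$$ $$q_1=q_0+h\sum_{i=1}^{s_1}b_iP_i,\qquad p_1=p_0+h\sum_{i=1}^{s_1}b_iF^1(Q_i)+h\sum_{k=1}^{s_2}\tilde b_kF^2(\tilde Q_k).$$ Then, both for the interpolation and for the collocation construction of $\tilde A$, the method has order $r=2(s_1-1)=2s_2$. That is, for all such $d,V^1,V^2$, every solution $(q,p)$ of the system on an interval $[0,T]$ with $T>0$, and every $\rho>0$, there are $h_0\in(0,T]$ and $K$ such that for all $0<h\le h_0$ the stage equations with $(q_0,p_0)=(q(0),p(0))$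 have exactly one solution with $\|P_i-p_0\|\le\rho$ for all $i$, and the resulting step satisfies $$\|q_1-q(h)\|\le K h^{r+1},\qquad \|p_1-p(h)\|\le K h^{r+1}.$$ -/

import Mathlib

open scoped ContDiff

noncomputable section

namespace SymplecticARK

open Polynomial

/-- A Runge--Kutta tableau `(A, b, c)` with `s` stages. -/
structure RKTableau (s : ℕ) where
  A : Matrix (Fin s) (Fin s) ℝ
  b : Fin s → ℝ
  c : Fin s → ℝ

/-- A quadrature formula on `[0, 1]` with `s` weights `b` and nodes `c`. -/
structure QuadratureRule (s : ℕ) where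
  b : Fin s → ℝ
  c : Fin s → ℝ

/-! ### Gauss--Legendre quadrature and the Lobatto IIIA method -/

/-- The `i`-th smallest distinct real root of `p`, counting from `i = 0`
(and `0` if `p` has at most `i` distinct real roots). -/
def sortedRoot (p : ℝ[X]) (i : ℕ) : ℝ :=
  (p.roots.toFinset.sort).getD i 0

/-- The `j`-th cardinal Lagrange polynomial `∏_{k ≠ j} (X - c_k) / (c_j - c_k)`. -/
def cardinal {s : ℕ} (c : Fin s → ℝ) (j : Fin s) : ℝ[X] :=
  Lagrange.basis Finset.univ c j

/-- The interpolatory quadrature weights `b_j = ∫₀¹ L_j` on the nodes `c`. -/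
def interpolatoryWeights {s : ℕ} (c : Fin s → ℝ) (j : Fin s) : ℝ :=
  ∫ x in (0 : ℝ)..1, (cardinal c j).eval x

/-- The matrix of coefficients `∫₀^{x_i} L_j(τ) dτ`, where `L_j` are the cardinal polynomials of
the nodes `c`. -/
def collocationMatrix {s m : ℕ} (c : Fin s → ℝ) (x : Fin m → ℝ) :
    Matrix (Fin m) (Fin s) ℝ :=
  Matrix.of fun i j => ∫ τ in (0 : ℝ)..(x i), (cardinal c j).eval τ

/-- The nodes of the `s`-stage Gauss--Legendre quadrature on `[0, 1]`: the zeros, in increasing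
order, of the `s`-th shifted Legendre polynomial. -/
def gaussNodes (s : ℕ) (i : Fin s) : ℝ :=
  sortedRoot ((shiftedLegendre s).map (Int.castRingHom ℝ)) i

/-- The `s`-stage Gauss--Legendre quadrature on `[0, 1]`. -/
def gaussLegendre (s : ℕ) : QuadratureRule s where
  b := interpolatoryWeights (gaussNodes s)
  c := gaussNodes s

/-- The nodes of the `s`-stage Lobatto quadrature on `[0, 1]` (`s ≥ 2`): the zeros, in increasing
order, of the polynomial `d^(s-2)/dx^(s-2) (x^(s-1) (x-1)^(s-1))` of degree `s`. -/
def lobattoNodes (s : ℕ) (i : Fin s) : ℝ :=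
  sortedRoot (derivative^[s - 2] ((X : ℝ[X]) ^ (s - 1) * (X - 1) ^ (s - 1))) i

/-- The `s`-stage Lobatto IIIA method (`s ≥ 2`): the collocation method on the Lobatto nodes. -/
def lobattoIIIA (s : ℕ) : RKTableau s where
  A := collocationMatrix (lobattoNodes s) (lobattoNodes s)
  b := interpolatoryWeights (lobattoNodes s)
  c := lobattoNodes s

/-! ### The additive methods -/

/-- The free coefficients of an additive method: the matrix `A` and weights `b` of the primary
method, and the matrix `At` (that is, `Ã`) and weights `bt` of the secondary one. -/
structure AdditiveMethod (s₁ s₂ : ℕ) where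
  A : Matrix (Fin s₁) (Fin s₁) ℝ
  b : Fin s₁ → ℝ
  At : Matrix (Fin s₂) (Fin s₁) ℝ
  bt : Fin s₂ → ℝ

/-- The symplectic partner `â_{ij} = b_j - b_j a_{ji} / b_i` of the primary matrix. If `A` is the
Lobatto IIIA matrix then this is the Lobatto IIIB matrix. -/
def AdditiveMethod.Ahat {s₁ s₂ : ℕ} (M : AdditiveMethod s₁ s₂) : Matrix (Fin s₁) (Fin s₁) ℝ :=
  Matrix.of fun i j => M.b j - M.b j * M.A j i / M.b i

/-- The symplectic partner `b̃_k - b̃_k ã_{ki} / b_i` of the secondary matrix. -/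
def AdditiveMethod.Athat {s₁ s₂ : ℕ} (M : AdditiveMethod s₁ s₂) : Matrix (Fin s₁) (Fin s₂) ℝ :=
  Matrix.of fun i k => M.bt k - M.bt k * M.At k i / M.b i

/-- The method with `Ã = 𝓛(c̃) A`, `𝓛(c̃)_{il} = L_l(c̃_i)`, obtained by interpolation of the
primary stages. -/
def interpolationMethod {s₁ s₂ : ℕ} (R : RKTableau s₁) (S : QuadratureRule s₂) :
    AdditiveMethod s₁ s₂ where
  A := R.A
  b := R.b
  At := (Matrix.of fun i l => (cardinal R.c l).eval (S.c i)) * R.A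
  bt := S.b

/-- The method with `ã_{ij} = ∫₀^{c̃_i} L_j(τ) dτ`, obtained by collocation. -/
def collocationMethod {s₁ s₂ : ℕ} (R : RKTableau s₁) (S : QuadratureRule s₂) :
    AdditiveMethod s₁ s₂ where
  A := R.A
  b := R.b
  At := collocationMatrix R.c S.c
  bt := S.b

/-- Internal stages `P_i`, `Q_i` (`i ≤ s₁`) and `Q̃_k` (`k ≤ s₂`) in the space `E`. -/
structure Stages (s₁ s₂ : ℕ) (E : Type*) where
  P : Fin s₁ → E
  Q : Fin s₁ → E
  Qt : Fin s₂ → E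

section Step

variable {s₁ s₂ : ℕ} {E : Type*} [AddCommGroup E] [Module ℝ E]

/-- The stage equations of the method for `q' = p`, `p' = F₁ q + F₂ q`, with step size `h` and
starting values `q₀`, `p₀`. -/
structure AdditiveMethod.IsStages (M : AdditiveMethod s₁ s₂) (F₁ F₂ : E → E) (h : ℝ) (q₀ p₀ : E)
    (Y : Stages s₁ s₂ E) : Prop where
  P_eq : ∀ i, Y.P i =
    p₀ + h • ∑ j, M.Ahat i j • F₁ (Y.Q j) + h • ∑ k, M.Athat i k • F₂ (Y.Qt k)
  Q_eq : ∀ i, Y.Q i = q₀ + h • ∑ j, M.A i j • Y.P j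
  Qt_eq : ∀ k, Y.Qt k = q₀ + h • ∑ j, M.At k j • Y.P j

/-- The new position `q₁ = q₀ + h ∑ b_i P_i`. -/
def AdditiveMethod.qNext (M : AdditiveMethod s₁ s₂) (h : ℝ) (q₀ : E) (Y : Stages s₁ s₂ E) : E :=
  q₀ + h • ∑ i, M.b i • Y.P i

/-- The new momentum `p₁ = p₀ + h ∑ b_i F₁(Q_i) + h ∑ b̃_k F₂(Q̃_k)`. -/
def AdditiveMethod.pNext (M : AdditiveMethod s₁ s₂) (F₁ F₂ : E → E) (h : ℝ) (p₀ : E)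
    (Y : Stages s₁ s₂ E) : E :=
  p₀ + h • ∑ i, M.b i • F₁ (Y.Q i) + h • ∑ k, M.bt k • F₂ (Y.Qt k)

end Step

/-- The method has order `r`. For all smooth potentials `V₁`, `V₂` on `ℝ^d` and every solution
`(q, p)` of `q' = p`, `p' = -∇V₁(q) - ∇V₂(q)` on an interval `[0, T]`: in every ball around
`p(0)`, for all small enough step sizes `h`, the stage equations started at `(q(0), p(0))` have
exactly one solution with the `P_i` in that ball, and the step `(q₁, p₁)` computed from it
satisfies `q₁ - q(h) = O(h^(r+1))` and `p₁ - p(h) = O(h^(r+1))`. -/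
def AdditiveMethod.HasOrder {s₁ s₂ : ℕ} (M : AdditiveMethod s₁ s₂) (r : ℕ) : Prop :=
  ∀ (d : ℕ) (V₁ V₂ : EuclideanSpace ℝ (Fin d) → ℝ),
    ContDiff ℝ ∞ V₁ → ContDiff ℝ ∞ V₂ →
    ∀ (F₁ F₂ : EuclideanSpace ℝ (Fin d) → EuclideanSpace ℝ (Fin d)),
    (∀ x, F₁ x = -gradient V₁ x) → (∀ x, F₂ x = -gradient V₂ x) →
    ∀ (T : ℝ) (q p : ℝ → EuclideanSpace ℝ (Fin d)), 0 < T →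
    (∀ t ∈ Set.Icc 0 T, HasDerivWithinAt q (p t) (Set.Icc 0 T) t) →
    (∀ t ∈ Set.Icc 0 T, HasDerivWithinAt p (F₁ (q t) + F₂ (q t)) (Set.Icc 0 T) t) →
    ∀ ρ : ℝ, 0 < ρ →
    ∃ h₀ K : ℝ, 0 < h₀ ∧ h₀ ≤ T ∧ ∀ h : ℝ, 0 < h → h ≤ h₀ →
      (∃! Y : Stages s₁ s₂ (EuclideanSpace ℝ (Fin d)),
        (∀ i, ‖Y.P i - p 0‖ ≤ ρ) ∧ M.IsStages F₁ F₂ h (q 0) (p 0) Y) ∧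
      ∀ Y : Stages s₁ s₂ (EuclideanSpace ℝ (Fin d)),
        (∀ i, ‖Y.P i - p 0‖ ≤ ρ) → M.IsStages F₁ F₂ h (q 0) (p 0) Y →
        ‖M.qNext h (q 0) Y - q h‖ ≤ K * h ^ (r + 1) ∧
        ‖M.pNext F₁ F₂ h (p 0) Y - p h‖ ≤ K * h ^ (r + 1)

end SymplecticARK

end

/-!
The proof avoids rooted trees. It is a discrete duality argument in the style of superconvergence
proofs for Galerkin methods.

Write `n = s₁ - 1 = m + 1`. The only facts about the tableau that enter are the classical
simplifying assumptions, collected in `IsCompatible`: both quadratures are exact for polynomials of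
degree less than `2 n`; the position stages integrate polynomials of degree less than `n` exactly;
and the transposed condition holds for degree less than `n - 1`, which says that the symplectic
partners integrate polynomials of that degree exactly. For the Lobatto and Gauss nodes these follow
from Rodrigues' formula: the polynomials `d^k/dx^k (x^n (x-1)^n)` have the right number of zeros in
the unit interval by Rolle's theorem (`card_unitRoots_rodrigues`), they are orthogonal to low
degrees by parts (`integral_rodrigues_mul`), and division with remainder gives the exactness
(`integratesDegreeLT_of_orthogonal`). The Lobatto weights do not vanish (`weights_ne_zero`), so
that the partners are defined without a division by zero. Interpolation and collocation both pass
the conditions on to `Ã` (`isCompatible_interpolation`, `isCompatible_collocation`).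

Let `E_i` and `e_x` be the errors of the momentum and position stages. They are `O(h^n)` and
`O(h^(n+1))` (`isBigO_momentum_error`, `isBigO_position_error`). To double the order, test the
momentum equation with an operator-valued polynomial `W` of degree `n` that solves the adjoint of
the linearised equation, `W'' = W F'(q)`, up to `O(t^(n-1))`. Because of the symplectic
partnership, the numerical solution satisfies the weak form
`W(h) p₁ - W(0) p₀ = h ∑ b_i (W' P)_i + h ∑ b_j (W F₁(Q))_j + h ∑ b̃_k (W F₂(Q̃))_k`
exactly, and the exact solution satisfies it up to a quadrature error `O(h^(2n+1))`. In the
difference, the forces are linearised with a remainder quadratic in `e_x`, and `W F'(q)` is replaced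
by `W''`; the transposed condition is a discrete summation by parts
(`isBigO_summation_by_parts`) that turns the position errors into momentum errors. What is left is
`W(h) (p₁ - p(h)) - W'(h) (q₁ - q(h)) = O(h^(2n+1))` (`isBigO_adjoint_error`), and the two choices
`(W(0), W'(0)) = (1, 0), (0, 1)` separate the two errors (`isBigO_step_error`).

Unique solvability of the stage equations in a given ball is a contraction argument
(`eventually_existsUnique_isStages`).
-/

namespace SymplecticARK

open Set Filter Topology Asymptotics

/-! ### Polynomial functions of one real variable with values in a normed space -/

section PolyLT

variable {E : Type*} [NormedAddCommGroup E] [NormedSpace ℝ E]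

/-- `f` is a polynomial function of degree less than `N` with coefficients in `E`. -/
def PolyLT (N : ℕ) (f : ℝ → E) : Prop :=
  ∃ A : ℕ → E, ∀ t, f t = ∑ k ∈ Finset.range N, t ^ k • A k

theorem PolyLT.zero : PolyLT 0 (fun _ : ℝ => (0 : E)) := ⟨0, fun t => by simp⟩

theorem PolyLT.contDiff {N : ℕ} {f : ℝ → E} (hf : PolyLT N f) : ContDiff ℝ ∞ f := by
  obtain ⟨A, hA⟩ := hf
  rw [show f = fun t => ∑ k ∈ Finset.range N, t ^ k • A k from funext hA]
  fun_prop

theorem PolyLT.add {N : ℕ} {f g : ℝ → E} (hf : PolyLT N f) (hg : PolyLT N g) :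
    PolyLT N (fun t => f t + g t) := by
  obtain ⟨A, hA⟩ := hf
  obtain ⟨B, hB⟩ := hg
  exact ⟨A + B, fun t => by simp [hA, hB, Finset.sum_add_distrib]⟩

theorem PolyLT.add_const {N : ℕ} {f : ℝ → E} (hf : PolyLT (N + 1) f) (a : E) :
    PolyLT (N + 1) (fun t => a + f t) := by
  obtain ⟨A, hA⟩ := hf
  refine ⟨fun k => if k = 0 then a + A 0 else A k, fun t => ?_⟩
  simp only [hA, Finset.sum_range_succ']
  simp [add_comm, add_assoc]

theorem hasDerivAt_sum_pow_smul (A : ℕ → E) (N : ℕ) (t : ℝ) :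
    HasDerivAt (fun t : ℝ => ∑ k ∈ Finset.range N, (t ^ (k + 1) / ((k : ℝ) + 1)) • A k)
      (∑ k ∈ Finset.range N, t ^ k • A k) t := by
  refine HasDerivAt.fun_sum fun k _ => HasDerivAt.smul_const ?_ _
  have h := (hasDerivAt_pow (k + 1) t).div_const ((k : ℝ) + 1)
  have hk : (k : ℝ) + 1 ≠ 0 := by positivity
  convert h using 1
  simp
  field_simp

theorem PolyLT.exists_primitive {N : ℕ} {f : ℝ → E} (hf : PolyLT N f) :
    ∃ G : ℝ → E, PolyLT (N + 1) G ∧ G 0 = 0 ∧ ∀ t, HasDerivAt G (f t) t := by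
  obtain ⟨A, hA⟩ := hf
  refine ⟨fun t => ∑ k ∈ Finset.range N, (t ^ (k + 1) / ((k : ℝ) + 1)) • A k, ?_, by simp, ?_⟩
  · refine ⟨fun k => ((k : ℝ))⁻¹ • A (k - 1), fun t => ?_⟩
    rw [Finset.sum_range_succ']
    simp [smul_smul, div_eq_mul_inv]
  · intro t
    rw [hA]
    exact hasDerivAt_sum_pow_smul A N t

/-- Taylor approximation at the left end point of an interval. -/
theorem exists_polyLT_approx {T : ℝ} (hT : 0 < T) {f : ℝ → E}
    (hf : ContDiffOn ℝ ∞ f (Icc 0 T)) (N : ℕ) :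
    ∃ g : ℝ → E, PolyLT N g ∧ ∃ K, 0 ≤ K ∧ ∀ t ∈ Icc 0 T, ‖f t - g t‖ ≤ K * t ^ N := by
  cases N with
  | zero =>
    obtain ⟨K, hK⟩ := isCompact_Icc.exists_bound_of_continuousOn hf.continuousOn
    exact ⟨_, PolyLT.zero, K, (norm_nonneg _).trans (hK 0 ⟨le_rfl, hT.le⟩),
      fun t ht => by simpa using hK t ht⟩
  | succ m =>
    obtain ⟨K, hK⟩ := exists_taylor_mean_remainder_bound (n := m) hT.le
      (hf.of_le (by exact_mod_cast le_top))
    refine ⟨fun t => taylorWithinEval f m (Icc 0 T) 0 t, ?_, |K|, abs_nonneg _, fun t ht => ?_⟩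
    · refine ⟨fun k => ((k.factorial : ℝ))⁻¹ • iteratedDerivWithin k f (Icc 0 T) 0, fun t => ?_⟩
      simp only [taylor_within_apply]
      exact Finset.sum_congr rfl fun k _ => by rw [smul_smul, sub_zero, mul_comm]
    · refine (hK t ht).trans ?_
      rw [sub_zero]
      exact mul_le_mul_of_nonneg_right (le_abs_self K) (pow_nonneg ht.1 _)

theorem exists_primitive_Icc [CompleteSpace E] {T : ℝ} (hT : 0 < T) {f : ℝ → E}
    (hf : ContinuousOn f (Icc 0 T)) :
    ∃ G : ℝ → E, ∀ t ∈ Icc 0 T, HasDerivWithinAt G (f t) (Icc 0 T) t := by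
  set f' : ℝ → E := IccExtend hT.le ((Icc 0 T).domRestrict f) with hf'
  have hc : Continuous f' := (continuousOn_iff_continuous_domRestrict.1 hf).Icc_extend'
  refine ⟨fun t => ∫ x in (0 : ℝ)..t, f' x, fun t ht => ?_⟩
  have h := (hc.integral_hasStrictDerivAt 0 t).hasDerivAt.hasDerivWithinAt (s := Icc 0 T)
  rwa [hf', IccExtend_of_mem _ _ ht] at h

/-- A function whose derivative is `O(t ^ N)` and which vanishes at `0` is `O(t ^ (N + 1))`. -/
theorem norm_sub_le_of_deriv_le_pow {T K : ℝ} {N : ℕ} (hK : 0 ≤ K) {G g : ℝ → E}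
    (hG : ∀ t ∈ Icc 0 T, HasDerivWithinAt G (g t) (Icc 0 T) t)
    (hg : ∀ t ∈ Icc 0 T, ‖g t‖ ≤ K * t ^ N) {t : ℝ} (ht : t ∈ Icc 0 T) :
    ‖G t - G 0‖ ≤ K * t ^ (N + 1) := by
  have hsub : Icc 0 t ⊆ Icc 0 T := Icc_subset_Icc_right ht.2
  have := Convex.norm_image_sub_le_of_norm_hasDerivWithin_le (f := G) (f' := g) (s := Icc 0 t)
    (C := K * t ^ N) (fun x hx => (hG x (hsub hx)).mono hsub)
    (fun x hx => (hg x (hsub hx)).trans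
      (mul_le_mul_of_nonneg_left (pow_le_pow_left₀ hx.1 hx.2 N) hK))
    (convex_Icc 0 t) ⟨le_rfl, ht.1⟩ ⟨ht.1, le_rfl⟩
  rwa [sub_zero, Real.norm_eq_abs, abs_of_nonneg ht.1, mul_assoc, ← pow_succ] at this

end PolyLT

/-! ### Quadrature formulas and their errors -/

section Quadrature

variable {E : Type*} [NormedAddCommGroup E] [NormedSpace ℝ E] {ι : Type*} [Fintype ι]

/-- The quadrature formula with weights `β` and nodes `γ` integrates polynomials of degree less
than `N` exactly over `[0, x]`. -/
def IsExact (N : ℕ) (β γ : ι → ℝ) (x : ℝ) : Prop :=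
  ∀ k < N, ∑ i, β i * γ i ^ k = x ^ (k + 1) / ((k : ℝ) + 1)

theorem IsExact.mono {M N : ℕ} {β γ : ι → ℝ} {x : ℝ} (h : IsExact N β γ x) (hMN : M ≤ N) :
    IsExact M β γ x := fun k hk => h k (hk.trans_le hMN)

/-- The exactness condition on monomials, scaled to `[0, h]` and applied to vector-valued
polynomials. -/
theorem IsExact.polyLT {N : ℕ} {β γ : ι → ℝ} {x : ℝ} (hx : IsExact N β γ x) {f G : ℝ → E}
    (hf : PolyLT N f) (hG : ∀ t, HasDerivAt G (f t) t) (h : ℝ) :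
    h • ∑ i, β i • f (γ i * h) = G (x * h) - G 0 := by
  obtain ⟨A, hA⟩ := hf
  have hP := hasDerivAt_sum_pow_smul A N
  simp only [← hA] at hP
  have hd : ∀ t, HasDerivAt (fun t => G t -
      ∑ k ∈ Finset.range N, (t ^ (k + 1) / ((k : ℝ) + 1)) • A k) 0 t := fun t => by
    simpa using (hG t).fun_sub (hP t)
  have hc := is_const_of_deriv_eq_zero (fun t => (hd t).differentiableAt)
    (fun t => (hd t).deriv) (x * h) 0
  simp only [ne_eq, Nat.add_eq_zero_iff, one_ne_zero, and_false, not_false_eq_true, zero_pow,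
    zero_div, zero_smul, Finset.sum_const_zero, sub_zero] at hc
  rw [← hc, sub_sub_cancel]
  simp only [hA, Finset.smul_sum]
  rw [Finset.sum_comm]
  refine Finset.sum_congr rfl fun k hk => ?_
  simp only [smul_smul, ← Finset.sum_smul]
  congr 1
  rw [mul_pow, mul_div_right_comm, ← hx k (Finset.mem_range.1 hk), Finset.sum_mul]
  exact Finset.sum_congr rfl fun i _ => by ring

/-- The error of a quadrature formula scaled to `[0, h]` and applied to a fixed smooth function. -/
theorem IsExact.isBigO {N : ℕ} {β γ : ι → ℝ} {x T : ℝ} (hT : 0 < T) (hx : IsExact N β γ x)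
    (hγ : ∀ i, γ i ∈ Icc (0 : ℝ) 1) (hx1 : x ∈ Icc (0 : ℝ) 1) {f G : ℝ → E}
    (hf : ContDiffOn ℝ ∞ f (Icc 0 T))
    (hG : ∀ t ∈ Icc 0 T, HasDerivWithinAt G (f t) (Icc 0 T) t) :
    (fun h : ℝ => h • ∑ i, β i • f (γ i * h) - (G (x * h) - G 0))
      =O[𝓝[>] 0] fun h => h ^ (N + 1) := by
  obtain ⟨g, hg, K, hK, hfg⟩ := exists_polyLT_approx hT hf N
  obtain ⟨P, -, -, hP⟩ := hg.exists_primitive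
  refine IsBigO.of_bound ((∑ i, |β i|) * K + K) ?_
  filter_upwards [Ioc_mem_nhdsGT hT] with h hh
  have mem : ∀ y ∈ Icc (0 : ℝ) 1, y * h ∈ Icc 0 T := fun y hy =>
    ⟨mul_nonneg hy.1 hh.1.le, (mul_le_of_le_one_left hh.1.le hy.2).trans hh.2⟩
  have hle : ∀ y ∈ Icc (0 : ℝ) 1, ∀ m : ℕ, (y * h) ^ m ≤ h ^ m := fun y hy m =>
    pow_le_pow_left₀ (mem y hy).1 (mul_le_of_le_one_left hh.1.le hy.2) m
  -- the polynomial part `g` of `f` does not contribute to the error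
  have e : h • ∑ i, β i • f (γ i * h) - (G (x * h) - G 0) =
      h • ∑ i, β i • (f (γ i * h) - g (γ i * h)) -
        ((G (x * h) - P (x * h)) - (G 0 - P 0)) := by
    simp only [smul_sub, Finset.sum_sub_distrib]
    rw [hx.polyLT hg hP h]
    abel
  have h1 : ‖h • ∑ i, β i • (f (γ i * h) - g (γ i * h))‖ ≤ h * ∑ i, |β i| * (K * h ^ N) := by
    rw [norm_smul, Real.norm_eq_abs, abs_of_pos hh.1]
    refine mul_le_mul_of_nonneg_left (norm_sum_le_of_le _ fun i _ => ?_) hh.1.le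
    rw [norm_smul, Real.norm_eq_abs]
    exact mul_le_mul_of_nonneg_left ((hfg _ (mem _ (hγ i))).trans
      (mul_le_mul_of_nonneg_left (hle _ (hγ i) N) hK)) (abs_nonneg _)
  have h2 : ‖(G (x * h) - P (x * h)) - (G 0 - P 0)‖ ≤ K * h ^ (N + 1) :=
    (norm_sub_le_of_deriv_le_pow (G := fun t => G t - P t) hK
      (fun t ht => (hG t ht).sub (hP t).hasDerivWithinAt) hfg (mem x hx1)).trans
      (mul_le_mul_of_nonneg_left (hle x hx1 _) hK)
  rw [e, Real.norm_eq_abs, abs_of_pos (pow_pos hh.1 _)]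
  refine (norm_sub_le _ _).trans ((add_le_add h1 h2).trans (le_of_eq ?_))
  rw [← Finset.sum_mul]
  ring

end Quadrature

/-! ### Powers of the step size as gauge functions -/

section Gauge

variable {E : Type*} [NormedAddCommGroup E] [NormedSpace ℝ E] {ι : Type*} [Fintype ι]

theorem isBigO_pow_of_le {k m : ℕ} (h : k ≤ m) :
    (fun t : ℝ => t ^ m) =O[𝓝[>] 0] fun t => t ^ k := by
  refine IsBigO.of_bound 1 ?_
  filter_upwards [Ioc_mem_nhdsGT one_pos] with t ht
  rw [one_mul, Real.norm_eq_abs, Real.norm_eq_abs, abs_of_pos (pow_pos ht.1 _),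
    abs_of_pos (pow_pos ht.1 _)]
  exact pow_le_pow_of_le_one ht.1.le ht.2 h

theorem isBigO_sum_smul {w : ι → ℝ} {f : ι → ℝ → E} {k : ℕ}
    (hf : ∀ i, f i =O[𝓝[>] 0] fun t => t ^ k) :
    (fun t : ℝ => t • ∑ i, w i • f i t) =O[𝓝[>] 0] fun t => t ^ (k + 1) := by
  have h1 : (fun t : ℝ => ∑ i, w i • f i t) =O[𝓝[>] 0] fun t => t ^ k :=
    IsBigO.fun_sum fun i _ => (hf i).const_smul_left (w i)
  simpa [pow_succ'] using (isBigO_refl (fun t : ℝ => t) (𝓝[>] 0)).smul h1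

theorem isBigO_clm_apply {F : Type*} [NormedAddCommGroup F] [NormedSpace ℝ F]
    {A : ℝ → E →L[ℝ] F} {v : ℝ → E} {j k : ℕ}
    (hA : A =O[𝓝[>] 0] fun t => t ^ j) (hv : v =O[𝓝[>] 0] fun t => t ^ k) :
    (fun t => A t (v t)) =O[𝓝[>] 0] fun t => t ^ (j + k) := by
  have h1 : (fun t => A t (v t)) =O[𝓝[>] 0] fun t => ‖A t‖ * ‖v t‖ :=
    isBigO_of_le _ fun t => by
      rw [norm_mul, norm_norm, norm_norm]
      exact (A t).le_opNorm _
  simp only [pow_add]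
  exact h1.trans (hA.norm_left.mul hv.norm_left)

end Gauge

section Nodes

variable {E : Type*} [NormedAddCommGroup E] {T : ℝ}

theorem eventually_mul_mem_Icc (hT : 0 < T) {x : ℝ} (hx : x ∈ Icc (0 : ℝ) 1) :
    ∀ᶠ t in 𝓝[>] (0 : ℝ), x * t ∈ Icc 0 T := by
  filter_upwards [Ioc_mem_nhdsGT hT] with t ht
  exact ⟨mul_nonneg hx.1 ht.1.le, (mul_le_of_le_one_left ht.1.le hx.2).trans ht.2⟩

theorem tendsto_comp_mul (hT : 0 < T) {f : ℝ → E} (hf : ContinuousOn f (Icc 0 T)) {x : ℝ}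
    (hx : x ∈ Icc (0 : ℝ) 1) : Tendsto (fun t => f (x * t)) (𝓝[>] 0) (𝓝 (f 0)) := by
  have h0 : Tendsto (fun t : ℝ => x * t) (𝓝[>] 0) (𝓝 0) := by
    have : Continuous fun t : ℝ => x * t := by fun_prop
    simpa using (this.tendsto 0).mono_left nhdsWithin_le_nhds
  exact (hf 0 ⟨le_rfl, hT.le⟩).tendsto.comp
    (tendsto_nhdsWithin_iff.2 ⟨h0, eventually_mul_mem_Icc hT hx⟩)

theorem isBigO_one_comp_mul (hT : 0 < T) {f : ℝ → E} (hf : ContinuousOn f (Icc 0 T)) {x : ℝ}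
    (hx : x ∈ Icc (0 : ℝ) 1) :
    (fun t => f (x * t)) =O[𝓝[>] 0] fun t : ℝ => t ^ 0 := by
  simpa using (tendsto_comp_mul hT hf hx).isBigO_one ℝ

theorem isBigO_one_comp (hT : 0 < T) {f : ℝ → E} (hf : ContinuousOn f (Icc 0 T)) :
    f =O[𝓝[>] 0] fun t : ℝ => t ^ 0 := by
  simpa using isBigO_one_comp_mul hT hf (x := 1) ⟨zero_le_one, le_rfl⟩

end Nodes

section Remainder

variable {E : Type*} [NormedAddCommGroup E] [NormedSpace ℝ E]

/-- The remainder of the first order Taylor expansion is quadratic, uniformly in the base point. -/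
theorem isBigO_sub_sub_fderiv {F : E → E} (hF : ContDiff ℝ ∞ F) {u v : ℝ → E} {y : E} {k : ℕ}
    (hu : Tendsto u (𝓝[>] 0) (𝓝 y)) (hv : Tendsto v (𝓝[>] 0) (𝓝 y))
    (huv : (fun t => u t - v t) =O[𝓝[>] 0] fun t => t ^ k) :
    (fun t => F (u t) - F (v t) - fderiv ℝ F (v t) (u t - v t)) =O[𝓝[>] 0]
      fun t => t ^ (2 * k) := by
  have hF' : ContDiff ℝ 1 (fderiv ℝ F) := (contDiff_infty_iff_fderiv.1 hF).2.of_le (by simp)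
  obtain ⟨K, s, hs, hK⟩ := hF'.contDiffAt.exists_lipschitzOnWith (x := y)
  obtain ⟨r, hr, hrs⟩ := Metric.mem_nhds_iff.1 hs
  have hFd : Differentiable ℝ F := hF.differentiable (by simp)
  have h1 : (fun t => F (u t) - F (v t) - fderiv ℝ F (v t) (u t - v t)) =O[𝓝[>] 0]
      fun t => ‖u t - v t‖ * ‖u t - v t‖ := by
    refine IsBigO.of_bound K ?_
    filter_upwards [hu (Metric.ball_mem_nhds y hr), hv (Metric.ball_mem_nhds y hr)] with t h1 h2
    rw [norm_mul, norm_norm, ← mul_assoc]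
    have hseg : segment ℝ (v t) (u t) ⊆ Metric.ball y r :=
      (convex_ball y r).segment_subset h2 h1
    refine Convex.norm_image_sub_le_of_norm_hasFDerivWithin_le' (s := segment ℝ (v t) (u t))
      (fun x _ => (hFd x).hasFDerivAt.hasFDerivWithinAt) (fun x hx => ?_)
      (convex_segment _ _) (left_mem_segment ℝ _ _) (right_mem_segment ℝ _ _)
    refine (hK.norm_sub_le (hrs (hseg hx)) (hrs h2)).trans ?_
    exact mul_le_mul_of_nonneg_left (norm_sub_le_of_mem_segment hx) K.2
  refine h1.trans ?_
  simpa [two_mul, pow_add] using huv.norm_left.mul huv.norm_left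

theorem isBigO_comp_sub {F : E → E} (hF : ContDiff ℝ ∞ F) {u v : ℝ → E} {y : E} {k : ℕ}
    (hu : Tendsto u (𝓝[>] 0) (𝓝 y)) (hv : Tendsto v (𝓝[>] 0) (𝓝 y))
    (huv : (fun t => u t - v t) =O[𝓝[>] 0] fun t => t ^ k) :
    (fun t => F (u t) - F (v t)) =O[𝓝[>] 0] fun t => t ^ k := by
  have hs := (hF.contDiffAt (x := y)).hasStrictFDerivAt (by simp)
  have := hs.isBigO_sub.comp_tendsto (hu.prodMk_nhds hv)
  exact this.trans huv

end Remainder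

/-! ### Polynomial solutions of the adjoint equation -/

section Adjoint

variable {E : Type*} [NormedAddCommGroup E] [NormedSpace ℝ E]

/-- An operator-valued polynomial `W`, with `W' = V` and `V = V 0 + G₁ + G₂`, which solves the
adjoint equation `W'' = W (M₁ + M₂)` on `[0, T]` up to an error `O(t ^ N)`; the right-hand side is
split as `W'' = g₁ + g₂`, where `g₁` and `g₂` approximate `W M₁` and `W M₂`, and `G₁`, `G₂` are
their primitives. -/
structure AdjointApprox (T : ℝ) (M₁ M₂ : ℝ → E →L[ℝ] E) (N : ℕ) where
  W : ℝ → E →L[ℝ] E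
  V : ℝ → E →L[ℝ] E
  G₁ : ℝ → E →L[ℝ] E
  G₂ : ℝ → E →L[ℝ] E
  g₁ : ℝ → E →L[ℝ] E
  g₂ : ℝ → E →L[ℝ] E
  poly_V : PolyLT (N + 1) V
  poly_g₁ : PolyLT N g₁
  poly_g₂ : PolyLT N g₂
  deriv_W : ∀ t, HasDerivAt W (V t) t
  deriv_G₁ : ∀ t, HasDerivAt G₁ (g₁ t) t
  deriv_G₂ : ∀ t, HasDerivAt G₂ (g₂ t) t
  V_eq : ∀ t, V t = V 0 + (G₁ t + G₂ t)
  smooth_W : ContDiff ℝ ∞ W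
  smooth_G₁ : ContDiff ℝ ∞ G₁
  smooth_G₂ : ContDiff ℝ ∞ G₂
  K : ℝ
  K_nonneg : 0 ≤ K
  approx₁ : ∀ t ∈ Icc 0 T, ‖W t * M₁ t - g₁ t‖ ≤ K * t ^ N
  approx₂ : ∀ t ∈ Icc 0 T, ‖W t * M₂ t - g₂ t‖ ≤ K * t ^ N

/-- Approximate polynomial solutions of the adjoint equation exist for all initial values and
all orders; they are found by Picard iteration, with a Taylor expansion in each step. -/
theorem exists_adjointApprox {T : ℝ} (hT : 0 < T) {M₁ M₂ : ℝ → E →L[ℝ] E}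
    (hM₁ : ContDiffOn ℝ ∞ M₁ (Icc 0 T)) (hM₂ : ContDiffOn ℝ ∞ M₂ (Icc 0 T))
    (W₀ V₀ : E →L[ℝ] E) (N : ℕ) :
    ∃ τ : AdjointApprox T M₁ M₂ N, τ.W 0 = W₀ ∧ τ.V 0 = V₀ := by
  -- one integration step: polynomials `g₁`, `g₂` determine `V` and `W`
  have key : ∀ (N : ℕ) (g₁ g₂ : ℝ → E →L[ℝ] E), PolyLT N g₁ → PolyLT N g₂ →
      ∃ W V G₁ G₂ : ℝ → E →L[ℝ] E, PolyLT (N + 1) V ∧ (∀ t, HasDerivAt W (V t) t) ∧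
        (∀ t, HasDerivAt G₁ (g₁ t) t) ∧ (∀ t, HasDerivAt G₂ (g₂ t) t) ∧
        (∀ t, V t = V₀ + (G₁ t + G₂ t)) ∧ ContDiff ℝ ∞ W ∧ ContDiff ℝ ∞ G₁ ∧ ContDiff ℝ ∞ G₂ ∧
        W 0 = W₀ ∧ V 0 = V₀ := by
    intro N g₁ g₂ h₁ h₂
    obtain ⟨G₁, p₁, z₁, d₁⟩ := h₁.exists_primitive
    obtain ⟨G₂, p₂, z₂, d₂⟩ := h₂.exists_primitive
    have hV := (p₁.add p₂).add_const V₀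
    obtain ⟨W, pW, zW, dW⟩ := hV.exists_primitive
    exact ⟨fun t => W₀ + W t, _, G₁, G₂, hV, fun t => (dW t).const_add W₀, d₁, d₂, fun _ => rfl,
      (pW.add_const W₀).contDiff, p₁.contDiff, p₂.contDiff, by simp [zW], by simp [z₁, z₂]⟩
  induction N with
  | zero =>
    obtain ⟨W, V, G₁, G₂, pV, dW, d₁, d₂, hV, sW, s₁, s₂, zW, zV⟩ :=
      key 0 _ _ PolyLT.zero PolyLT.zero
    obtain ⟨K₁, hK₁⟩ := isCompact_Icc.exists_bound_of_continuousOn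
      (sW.continuous.continuousOn.mul hM₁.continuousOn)
    obtain ⟨K₂, hK₂⟩ := isCompact_Icc.exists_bound_of_continuousOn
      (sW.continuous.continuousOn.mul hM₂.continuousOn)
    exact ⟨⟨W, V, G₁, G₂, _, _, pV, PolyLT.zero, PolyLT.zero, dW, d₁, d₂,
      by rwa [zV], sW, s₁, s₂, max K₁ K₂,
      ((norm_nonneg _).trans (hK₁ 0 ⟨le_rfl, hT.le⟩)).trans (le_max_left _ _),
      fun t ht => by simpa using Or.inl (hK₁ t ht),
      fun t ht => by simpa using Or.inr (hK₂ t ht)⟩, zW, zV⟩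
  | succ N ih =>
    obtain ⟨τ, hτW, hτV⟩ := ih
    obtain ⟨g₁, p₁, K₁, hK₁, e₁⟩ := exists_polyLT_approx hT
      (f := fun t => τ.W t * M₁ t) (τ.smooth_W.contDiffOn.clm_comp hM₁) (N + 1)
    obtain ⟨g₂, p₂, K₂, hK₂, e₂⟩ := exists_polyLT_approx hT
      (f := fun t => τ.W t * M₂ t) (τ.smooth_W.contDiffOn.clm_comp hM₂) (N + 1)
    obtain ⟨W, V, G₁, G₂, pV, dW, d₁, d₂, hV, sW, s₁, s₂, zW, zV⟩ := key (N + 1) g₁ g₂ p₁ p₂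
    obtain ⟨C₁, hC₁⟩ := isCompact_Icc.exists_bound_of_continuousOn hM₁.continuousOn
    obtain ⟨C₂, hC₂⟩ := isCompact_Icc.exists_bound_of_continuousOn hM₂.continuousOn
    have nC₁ := (norm_nonneg _).trans (hC₁ 0 ⟨le_rfl, hT.le⟩)
    have nC₂ := (norm_nonneg _).trans (hC₂ 0 ⟨le_rfl, hT.le⟩)
    -- the two iterates differ by `O(t ^ (N + 2))`
    set K' := 2 * τ.K + (K₁ + K₂) * T with hK'
    have nK' : 0 ≤ K' := by have := τ.K_nonneg; positivity
    have d2 : ∀ t ∈ Icc 0 T, ‖(g₁ t + g₂ t) - (τ.g₁ t + τ.g₂ t)‖ ≤ K' * t ^ N := by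
      intro t ht
      have a₁ := e₁ t ht
      have a₂ := e₂ t ht
      have b₁ := τ.approx₁ t ht
      have b₂ := τ.approx₂ t ht
      have hp : 0 ≤ t ^ N := pow_nonneg ht.1 N
      have hpT : (K₁ + K₂) * t ^ (N + 1) ≤ (K₁ + K₂) * (t ^ N * T) := by
        rw [pow_succ]
        gcongr
        exact ht.2
      calc ‖(g₁ t + g₂ t) - (τ.g₁ t + τ.g₂ t)‖
          = ‖(τ.W t * M₁ t - τ.g₁ t) + (τ.W t * M₂ t - τ.g₂ t)
              - (τ.W t * M₁ t - g₁ t) - (τ.W t * M₂ t - g₂ t)‖ := by congr 1; abel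
        _ ≤ ‖τ.W t * M₁ t - τ.g₁ t‖ + ‖τ.W t * M₂ t - τ.g₂ t‖
              + ‖τ.W t * M₁ t - g₁ t‖ + ‖τ.W t * M₂ t - g₂ t‖ :=
            (norm_sub_le _ _).trans (add_le_add_left ((norm_sub_le _ _).trans
              (add_le_add_left (norm_add_le _ _) _)) _)
        _ ≤ K' * t ^ N := by rw [hK']; nlinarith
    have dVd : ∀ t ∈ Icc 0 T, ‖V t - τ.V t‖ ≤ K' * t ^ (N + 1) := by
      intro t ht
      have := norm_sub_le_of_deriv_le_pow (T := T) (G := fun t => (G₁ t + G₂ t) - (τ.G₁ t + τ.G₂ t))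
        nK' (fun t _ => (((d₁ t).fun_add (d₂ t)).fun_sub
          ((τ.deriv_G₁ t).fun_add (τ.deriv_G₂ t))).hasDerivWithinAt) d2 ht
      have z := hV 0
      have z' := τ.V_eq 0
      rw [zV, left_eq_add] at z
      rw [left_eq_add] at z'
      simp only [z, z', sub_zero] at this
      rwa [hV t, τ.V_eq t, hτV, add_sub_add_left_eq_sub]
    have dWd : ∀ t ∈ Icc 0 T, ‖W t - τ.W t‖ ≤ K' * t ^ (N + 2) := by
      intro t ht
      have := norm_sub_le_of_deriv_le_pow (T := T) (G := fun t => W t - τ.W t)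
        nK' (fun t _ => ((dW t).fun_sub (τ.deriv_W t)).hasDerivWithinAt) dVd ht
      simpa only [zW, hτW, sub_self, sub_zero] using this
    have fin : ∀ (M g : ℝ → E →L[ℝ] E) (K C : ℝ), 0 ≤ C → (∀ t ∈ Icc 0 T, ‖M t‖ ≤ C) →
        (∀ t ∈ Icc 0 T, ‖τ.W t * M t - g t‖ ≤ K * t ^ (N + 1)) →
        ∀ t ∈ Icc 0 T, ‖W t * M t - g t‖ ≤ (K + K' * T * C) * t ^ (N + 1) := by
      intro M g K C nC hC hg t ht
      have hp : 0 ≤ t ^ (N + 1) := pow_nonneg ht.1 _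
      calc ‖W t * M t - g t‖ = ‖(τ.W t * M t - g t) + (W t - τ.W t) * M t‖ := by
            congr 1; rw [sub_mul]; abel
        _ ≤ K * t ^ (N + 1) + (K' * t ^ (N + 2)) * C :=
            (norm_add_le _ _).trans (add_le_add (hg t ht) ((norm_mul_le _ _).trans
              (mul_le_mul (dWd t ht) (hC t ht) (norm_nonneg _)
                (mul_nonneg nK' (pow_nonneg ht.1 _)))))
        _ ≤ K * t ^ (N + 1) + (K' * (t ^ (N + 1) * T)) * C := by
            rw [pow_succ _ (N + 1)]
            gcongr
            exact ht.2
        _ = _ := by ring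
    have nKT : 0 ≤ K' * T := mul_nonneg nK' hT.le
    refine ⟨⟨W, V, G₁, G₂, g₁, g₂, pV, p₁, p₂, dW, d₁, d₂, by rwa [zV], sW, s₁, s₂,
      (K₁ + K' * T * C₁) + (K₂ + K' * T * C₂), by positivity,
      fun t ht => (fin M₁ g₁ K₁ C₁ nC₁ hC₁ e₁ t ht).trans ?_,
      fun t ht => (fin M₂ g₂ K₂ C₂ nC₂ hC₂ e₂ t ht).trans ?_⟩, zW, zV⟩
    · exact mul_le_mul_of_nonneg_right (le_add_of_nonneg_right (by positivity))
        (pow_nonneg ht.1 _)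
    · exact mul_le_mul_of_nonneg_right (le_add_of_nonneg_left (by positivity))
        (pow_nonneg ht.1 _)

end Adjoint

/-! ### Local error of additive methods satisfying the simplifying assumptions -/

/-- The simplifying assumptions of order `2 * (m + 1)` for a family of position stages
`Q_x = q₀ + h ∑ α x j P_j` with weights `β` and nodes `γ`, relative to the weights `b` and nodes `c`
of the momentum stages `P_j`.
The field `hatRow` is the transposed condition `∑ β_x γ_x^k α_{xi} = b_i (1 - c_i^(k+1)) / (k+1)`,
written as a quadrature condition for the symplectic partner of `α`. -/
structure IsCompatible {κ ι : Type*} [Fintype κ] [Fintype ι] (m : ℕ) (b c : κ → ℝ) (β γ : ι → ℝ)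
    (α : ι → κ → ℝ) : Prop where
  mem : ∀ x, γ x ∈ Icc (0 : ℝ) 1
  quad : IsExact (2 * (m + 1)) β γ 1
  row : ∀ x, IsExact (m + 1) (α x) c (γ x)
  hatRow : ∀ i, IsExact m (fun x => β x - β x * α x i / b i) γ (c i)

section Family

variable {E : Type*} [NormedAddCommGroup E] [NormedSpace ℝ E]
variable {κ ι : Type*} [Fintype κ] [Fintype ι] {m : ℕ} {b c : κ → ℝ} {β γ : ι → ℝ}
  {α : ι → κ → ℝ} {T : ℝ} {q p : ℝ → E} {P : ℝ → κ → E} {Q : ℝ → ι → E} {F : E → E}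

/-- Position stages are one order more accurate than the momentum stages they are built from, up to
the order `m + 2` of their own consistency error. -/
theorem isBigO_position_error (H : IsCompatible m b c β γ α) (hT : 0 < T)
    (hc : ∀ i, c i ∈ Icc (0 : ℝ) 1) (hp : ContDiffOn ℝ ∞ p (Icc 0 T))
    (hq : ∀ t ∈ Icc 0 T, HasDerivWithinAt q (p t) (Icc 0 T) t)
    (hQ : ∀ᶠ h in 𝓝[>] (0 : ℝ), ∀ x, Q h x = q 0 + h • ∑ j, α x j • P h j) {k : ℕ}
    (hk : k ≤ m + 1)
    (hP : ∀ j, (fun h => P h j - p (c j * h)) =O[𝓝[>] 0] fun h => h ^ k) (x : ι) :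
    (fun h => Q h x - q (γ x * h)) =O[𝓝[>] 0] fun h => h ^ (k + 1) := by
  have h1 := isBigO_sum_smul (w := α x) hP
  have h2 := ((H.row x).isBigO hT hc (H.mem x) hp hq).trans
    (isBigO_pow_of_le (by omega : k + 1 ≤ m + 1 + 1))
  refine (h1.add h2).congr' ?_ EventuallyEq.rfl
  filter_upwards [hQ] with h hh
  simp only [hh, smul_sub, Finset.sum_sub_distrib]
  abel

/-- The contribution of one force to the error of a momentum stage. -/
theorem isBigO_hatRow_error (H : IsCompatible m b c β γ α) (hT : 0 < T)
    (hc : ∀ i, c i ∈ Icc (0 : ℝ) 1) (hF : ContDiff ℝ ∞ F) (hqs : ContDiffOn ℝ ∞ q (Icc 0 T))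
    {Φ : ℝ → E} (hΦ : ∀ t ∈ Icc 0 T, HasDerivWithinAt Φ (F (q t)) (Icc 0 T) t) {k : ℕ}
    (hk : k ≤ m) (hQq : ∀ x, (fun h => Q h x - q (γ x * h)) =O[𝓝[>] 0] fun h => h ^ (k + 1))
    (i : κ) :
    (fun h => h • ∑ x, (β x - β x * α x i / b i) • F (Q h x) - (Φ (c i * h) - Φ 0))
      =O[𝓝[>] 0] fun h => h ^ (k + 1) := by
  have hq0 := fun x => tendsto_comp_mul hT hqs.continuousOn (H.mem x)
  have hQ0 : ∀ x, Tendsto (fun h => Q h x) (𝓝[>] 0) (𝓝 (q 0)) := fun x => by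
    have h0 : Tendsto (fun h : ℝ => h ^ (k + 1)) (𝓝[>] 0) (𝓝 0) := by
      have : Continuous fun h : ℝ => h ^ (k + 1) := by fun_prop
      simpa using (this.tendsto 0).mono_left nhdsWithin_le_nhds
    simpa using ((hQq x).trans_tendsto h0).add (hq0 x)
  have h1 := isBigO_sum_smul (w := fun x => β x - β x * α x i / b i)
    fun x => isBigO_comp_sub hF (hQ0 x) (hq0 x) (hQq x)
  have h2 := (H.hatRow i).isBigO hT H.mem (hc i) (hF.comp_contDiffOn hqs) hΦ
  refine ((h1.trans (isBigO_pow_of_le (by omega))).add (h2.trans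
    (isBigO_pow_of_le (by omega)))).congr_left fun h => ?_
  simp only [smul_sub, Finset.sum_sub_distrib, Function.comp_apply]
  abel

/-- The adjoint identity: summation by parts turns a weighted sum of position errors into
a weighted sum of momentum errors. -/
theorem isBigO_summation_by_parts [CompleteSpace E] (H : IsCompatible m b c β γ α) (hT : 0 < T)
    (hb : ∀ i, b i ≠ 0) (hc : ∀ i, c i ∈ Icc (0 : ℝ) 1) (hbc : IsExact (2 * (m + 1)) b c 1)
    (hqs : ContDiffOn ℝ ∞ q (Icc 0 T)) (hp : ContDiffOn ℝ ∞ p (Icc 0 T))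
    (hq : ∀ t ∈ Icc 0 T, HasDerivWithinAt q (p t) (Icc 0 T) t)
    (hQ : ∀ᶠ h in 𝓝[>] (0 : ℝ), ∀ x, Q h x = q 0 + h • ∑ j, α x j • P h j)
    {g G : ℝ → E →L[ℝ] E} (hg : PolyLT m g) (hG : ∀ t, HasDerivAt G (g t) t)
    (hGs : ContDiff ℝ ∞ G) :
    (fun h => h • ∑ x, β x • g (γ x * h) (Q h x - q (γ x * h)) -
      h • ∑ i, b i • (G h - G (c i * h)) (P h i - p (c i * h)))
      =O[𝓝[>] 0] fun h => h ^ (2 * m + 3) := by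
  have hgs := hg.contDiff
  have one : (1 : ℝ) ∈ Icc (0 : ℝ) 1 := ⟨zero_le_one, le_rfl⟩
  -- numerical solution: an exact identity
  have num : ∀ᶠ h in 𝓝[>] (0 : ℝ), h • ∑ x, β x • g (γ x * h) (Q h x - q 0) =
      h • ∑ i, b i • (G h - G (c i * h)) (P h i) := by
    filter_upwards [hQ] with h hh
    have hbar : ∀ i, h • ∑ x, (β x * α x i) • g (γ x * h) = b i • (G h - G (c i * h)) := by
      intro i
      have e1 := (H.quad.mono (by omega : m ≤ 2 * (m + 1))).polyLT hg hG h
      have e2 := (H.hatRow i).polyLT hg hG h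
      rw [one_mul] at e1
      have e3 : h • ∑ x, (β x * α x i / b i) • g (γ x * h) = G h - G (c i * h) := by
        rw [← sub_sub_sub_cancel_right (G h) _ (G 0), ← e1, ← e2]
        simp only [sub_smul, smul_sub, Finset.sum_sub_distrib, sub_sub_cancel]
      rw [← e3, smul_comm (b i) h, Finset.smul_sum (r := b i)]
      congr 1
      refine Finset.sum_congr rfl fun x _ => ?_
      rw [smul_smul, mul_div_cancel₀ _ (hb i)]
    calc h • ∑ x, β x • g (γ x * h) (Q h x - q 0)
        = h • ∑ x, ∑ i, h • (β x * α x i) • g (γ x * h) (P h i) := by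
          congr 1
          refine Finset.sum_congr rfl fun x _ => ?_
          rw [hh x, add_sub_cancel_left, map_smul, map_sum, smul_comm, Finset.smul_sum,
            Finset.smul_sum]
          refine Finset.sum_congr rfl fun i _ => ?_
          rw [map_smul, smul_smul (β x)]
      _ = h • ∑ i, (h • ∑ x, (β x * α x i) • g (γ x * h)) (P h i) := by
          rw [Finset.sum_comm]
          congr 1
          refine Finset.sum_congr rfl fun i _ => ?_
          simp [Finset.smul_sum]
      _ = _ := by
          congr 1
          refine Finset.sum_congr rfl fun i _ => ?_
          rw [hbar]
          rfl
  -- exact solution: integration by parts up to quadrature errors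
  have f1s : ContDiffOn ℝ ∞ (fun t => g t (q t - q 0)) (Icc 0 T) :=
    hgs.contDiffOn.clm_apply (hqs.sub contDiffOn_const)
  obtain ⟨J, hJ⟩ := exists_primitive_Icc hT f1s.continuousOn
  have r1 := H.quad.isBigO hT H.mem one f1s hJ
  have r2 := hbc.isBigO hT hc one hp hq
  have r3 := hbc.isBigO hT hc one (f := fun t => G t (p t))
    (G := fun t => G t (q t - q 0) - J t)
    (hGs.contDiffOn.clm_apply hp) (fun t ht => by
      have := (((hG t).hasDerivWithinAt (s := Icc 0 T)).clm_apply
        ((hq t ht).sub_const (q 0))).fun_sub (hJ t ht)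
      simpa using this)
  have r2' := isBigO_clm_apply (isBigO_one_comp hT hGs.continuous.continuousOn) r2
  rw [zero_add] at r2'
  have e : 2 * (m + 1) + 1 = 2 * m + 3 := by ring
  rw [e] at r1 r2' r3
  refine ((r1.add r3).sub r2').neg_left.congr' ?_ EventuallyEq.rfl
  filter_upwards [num] with h hh
  have s1 : h • ∑ x, β x • g (γ x * h) (Q h x - q (γ x * h)) =
      h • ∑ x, β x • g (γ x * h) (Q h x - q 0) -
        h • ∑ x, β x • g (γ x * h) (q (γ x * h) - q 0) := by
    rw [← smul_sub, ← Finset.sum_sub_distrib]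
    congr 1
    refine Finset.sum_congr rfl fun x _ => ?_
    rw [← smul_sub, ← map_sub, sub_sub_sub_cancel_right]
  have s2 : h • ∑ i, b i • (G h - G (c i * h)) (P h i - p (c i * h)) =
      h • ∑ i, b i • (G h - G (c i * h)) (P h i) -
        (G h (h • ∑ i, b i • p (c i * h)) - h • ∑ i, b i • G (c i * h) (p (c i * h))) := by
    simp only [map_smul, map_sum, map_sub, smul_sub, Finset.sum_sub_distrib,
      sub_apply]
  rw [s1, s2, hh]
  simp only [one_mul, sub_self, map_zero, zero_sub, map_sub]
  abel

/-- The contribution of one force to the error of the weak form of the momentum equation: up to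
`O(h ^ (2 * m + 3))` it is a weighted sum of momentum errors. -/
theorem isBigO_force_error [CompleteSpace E] (H : IsCompatible m b c β γ α) (hT : 0 < T)
    (hb : ∀ i, b i ≠ 0) (hc : ∀ i, c i ∈ Icc (0 : ℝ) 1) (hbc : IsExact (2 * (m + 1)) b c 1)
    (hF : ContDiff ℝ ∞ F)
    (hqs : ContDiffOn ℝ ∞ q (Icc 0 T)) (hp : ContDiffOn ℝ ∞ p (Icc 0 T))
    (hq : ∀ t ∈ Icc 0 T, HasDerivWithinAt q (p t) (Icc 0 T) t)
    (hQ : ∀ᶠ h in 𝓝[>] (0 : ℝ), ∀ x, Q h x = q 0 + h • ∑ j, α x j • P h j)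
    (hQq : ∀ x, (fun h => Q h x - q (γ x * h)) =O[𝓝[>] 0] fun h => h ^ (m + 2))
    {W g G : ℝ → E →L[ℝ] E} (hW : ContDiff ℝ ∞ W)
    (hg : PolyLT m g) (hG : ∀ t, HasDerivAt G (g t) t)
    (hGs : ContDiff ℝ ∞ G) {K : ℝ} (hK : 0 ≤ K)
    (hWg : ∀ t ∈ Icc 0 T, ‖W t * fderiv ℝ F (q t) - g t‖ ≤ K * t ^ m) :
    (fun h => h • ∑ x, β x • W (γ x * h) (F (Q h x) - F (q (γ x * h))) -
      h • ∑ i, b i • (G h - G (c i * h)) (P h i - p (c i * h)))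
      =O[𝓝[>] 0] fun h => h ^ (2 * m + 3) := by
  have hq0 := fun x => tendsto_comp_mul hT hqs.continuousOn (H.mem x)
  have hQ0 : ∀ x, Tendsto (fun h => Q h x) (𝓝[>] 0) (𝓝 (q 0)) := fun x => by
    have h0 : Tendsto (fun h : ℝ => h ^ (m + 2)) (𝓝[>] 0) (𝓝 0) := by
      have : Continuous fun h : ℝ => h ^ (m + 2) := by fun_prop
      simpa using (this.tendsto 0).mono_left nhdsWithin_le_nhds
    simpa using ((hQq x).trans_tendsto h0).add (hq0 x)
  -- `a1`: linearisation of `F`; `a2`: replacing `W F'(q)` by `g`; `a3`: summation by parts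
  have a1 := isBigO_sum_smul (w := β) fun x => (isBigO_clm_apply
    (isBigO_one_comp_mul hT hW.continuous.continuousOn (H.mem x))
    (isBigO_sub_sub_fderiv hF (hQ0 x) (hq0 x) (hQq x))).trans
    (isBigO_pow_of_le (by omega : 2 * m + 2 ≤ 0 + 2 * (m + 2)))
  have a2 := isBigO_sum_smul (w := β) (k := 2 * m + 2) fun x => by
    have hd : (fun h => W (γ x * h) * fderiv ℝ F (q (γ x * h)) - g (γ x * h)) =O[𝓝[>] 0]
        fun h : ℝ => h ^ m := by
      refine IsBigO.of_bound K ?_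
      filter_upwards [eventually_mul_mem_Icc hT (H.mem x), self_mem_nhdsWithin] with h hh hpos
      refine (hWg _ hh).trans (mul_le_mul_of_nonneg_left ?_ hK)
      refine (pow_le_pow_left₀ hh.1 ?_ m).trans (le_abs_self _)
      exact mul_le_of_le_one_left (le_of_lt hpos) (H.mem x).2
    have := isBigO_clm_apply hd (hQq x)
    rwa [show m + (m + 2) = 2 * m + 2 by ring] at this
  have a3 := isBigO_summation_by_parts H hT hb hc hbc hqs hp hq hQ hg hG hGs
  refine ((a1.add a2).add a3).congr_left fun h => ?_
  rw [← add_sub_assoc]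
  congr 1
  simp only [← smul_add, ← Finset.sum_add_distrib]
  congr 1
  refine Finset.sum_congr rfl fun x _ => ?_
  congr 1
  simp

end Family

section Order

variable {E : Type*} [NormedAddCommGroup E] [NormedSpace ℝ E]

/-- Solutions of `q'' = F q` with smooth `F` are smooth up to the boundary of the interval. -/
theorem contDiffOn_of_isSolution {T : ℝ} (hT : 0 < T) {F : E → E} (hF : ContDiff ℝ ∞ F)
    {q p : ℝ → E} (hq : ∀ t ∈ Icc 0 T, HasDerivWithinAt q (p t) (Icc 0 T) t)
    (hp : ∀ t ∈ Icc 0 T, HasDerivWithinAt p (F (q t)) (Icc 0 T) t) :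
    ContDiffOn ℝ ∞ q (Icc 0 T) ∧ ContDiffOn ℝ ∞ p (Icc 0 T) := by
  have hu : UniqueDiffOn ℝ (Icc 0 T) := uniqueDiffOn_Icc hT
  have step : ∀ (f f' : ℝ → E) (n : ℕ), (∀ t ∈ Icc 0 T, HasDerivWithinAt f (f' t) (Icc 0 T) t) →
      ContDiffOn ℝ n f' (Icc 0 T) → ContDiffOn ℝ (n + 1 : ℕ) f (Icc 0 T) := by
    intro f f' n hf hf'
    rw [Nat.cast_add, Nat.cast_one, contDiffOn_succ_iff_derivWithin hu]
    exact ⟨fun t ht => (hf t ht).differentiableWithinAt, by simp,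
      hf'.congr fun t ht => (hf t ht).derivWithin (hu t ht)⟩
  have key : ∀ n : ℕ, ContDiffOn ℝ n q (Icc 0 T) ∧ ContDiffOn ℝ n p (Icc 0 T) := by
    intro n
    induction n with
    | zero =>
      simp only [Nat.cast_zero, contDiffOn_zero]
      exact ⟨fun t ht => (hq t ht).continuousWithinAt, fun t ht => (hp t ht).continuousWithinAt⟩
    | succ n ih =>
      refine ⟨step q p n hq ih.2, step p (fun t => F (q t)) n hp ?_⟩
      exact (hF.of_le (by exact_mod_cast le_top)).comp_contDiffOn ih.1
  exact ⟨contDiffOn_infty.2 fun n => (key n).1, contDiffOn_infty.2 fun n => (key n).2⟩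

/-- The terms with `β_x α_{xi} / b_i` of the symplectic partner, tested against the derivative `V`
of an operator-valued polynomial `W`. -/
theorem sum_test_hatRow {κ ι : Type*} [Fintype κ] [Fintype ι] {m : ℕ} {b c : κ → ℝ} {β γ : ι → ℝ}
    {α : ι → κ → ℝ} (H : IsCompatible m b c β γ α) (hb : ∀ i, b i ≠ 0) {V W : ℝ → E →L[ℝ] E}
    (hV : PolyLT (m + 1) V) (hW : ∀ t, HasDerivAt W (V t) t) (f : ι → E) (h : ℝ) :
    h • ∑ i, b i • V (c i * h) (∑ x, (β x * α x i / b i) • f x) =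
      ∑ x, β x • W (γ x * h) (f x) - W 0 (∑ x, β x • f x) := by
  calc h • ∑ i, b i • V (c i * h) (∑ x, (β x * α x i / b i) • f x)
      = ∑ x, β x • (h • ∑ i, α x i • V (c i * h)) (f x) := by
        simp only [map_sum, map_smul, Finset.smul_sum, sum_apply,
          smul_apply]
        rw [Finset.sum_comm]
        refine Finset.sum_congr rfl fun x _ => Finset.sum_congr rfl fun i _ => ?_
        simp only [smul_smul]
        congr 1
        have := hb i
        field_simp
    _ = _ := by
        simp only [(H.row _).polyLT hV hW h, sub_apply, smul_sub, Finset.sum_sub_distrib,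
          map_sum, map_smul]

variable [CompleteSpace E] {s₁ s₂ m : ℕ} {M : AdditiveMethod s₁ s₂} {c : Fin s₁ → ℝ}
  {γ : Fin s₂ → ℝ} {T : ℝ} {q p : ℝ → E} {F₁ F₂ : E → E} {Y : ℝ → Stages s₁ s₂ E}

/-- Bounded momentum stages have error `O(h ^ (m + 1))`, by bootstrapping. -/
theorem isBigO_momentum_error (H₁ : IsCompatible m M.b c M.b c M.A)
    (H₂ : IsCompatible m M.b c M.bt γ M.At) (hT : 0 < T)
    (hF₁ : ContDiff ℝ ∞ F₁) (hF₂ : ContDiff ℝ ∞ F₂)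
    (hq : ∀ t ∈ Icc 0 T, HasDerivWithinAt q (p t) (Icc 0 T) t)
    (hp : ∀ t ∈ Icc 0 T, HasDerivWithinAt p (F₁ (q t) + F₂ (q t)) (Icc 0 T) t)
    (hY : ∀ᶠ h in 𝓝[>] (0 : ℝ), M.IsStages F₁ F₂ h (q 0) (p 0) (Y h))
    (hbd : ∀ i, (fun h => (Y h).P i) =O[𝓝[>] 0] fun h : ℝ => h ^ 0) {k : ℕ} (hk : k ≤ m + 1)
    (i : Fin s₁) : (fun h => (Y h).P i - p (c i * h)) =O[𝓝[>] 0] fun h => h ^ k := by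
  obtain ⟨hqs, hps⟩ := contDiffOn_of_isSolution hT (hF₁.add hF₂) hq hp
  induction k generalizing i with
  | zero => exact (hbd i).sub (isBigO_one_comp_mul hT hps.continuousOn (H₁.mem i))
  | succ k ih =>
    have ih' := fun i => ih (by omega) i
    have hQ := isBigO_position_error (Q := fun h => (Y h).Q) H₁ hT H₁.mem hps hq
      (hY.mono fun h hh => hh.Q_eq) (by omega) ih'
    have hQt := isBigO_position_error (Q := fun h => (Y h).Qt) H₂ hT H₁.mem hps hq
      (hY.mono fun h hh => hh.Qt_eq) (by omega) ih'
    obtain ⟨Φ, hΦ⟩ := exists_primitive_Icc hT (hF₁.continuous.comp_continuousOn hqs.continuousOn)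
    have e₁ := isBigO_hatRow_error H₁ hT H₁.mem hF₁ hqs hΦ (by omega) hQ i
    have e₂ := isBigO_hatRow_error (Φ := fun t => p t - Φ t) H₂ hT H₁.mem hF₂ hqs
      (fun t ht => by simpa using (hp t ht).fun_sub (hΦ t ht)) (by omega) hQt i
    refine (e₁.add e₂).congr' ?_ EventuallyEq.rfl
    filter_upwards [hY] with h hh
    rw [hh.P_eq]
    simp only [AdditiveMethod.Ahat, AdditiveMethod.Athat, Matrix.of_apply]
    abel

/-- The error of a step, tested with an approximate solution of the adjoint equation. -/
theorem isBigO_adjoint_error (hb : ∀ i, M.b i ≠ 0) (H₁ : IsCompatible m M.b c M.b c M.A)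
    (H₂ : IsCompatible m M.b c M.bt γ M.At) (hT : 0 < T)
    (hF₁ : ContDiff ℝ ∞ F₁) (hF₂ : ContDiff ℝ ∞ F₂)
    (hq : ∀ t ∈ Icc 0 T, HasDerivWithinAt q (p t) (Icc 0 T) t)
    (hp : ∀ t ∈ Icc 0 T, HasDerivWithinAt p (F₁ (q t) + F₂ (q t)) (Icc 0 T) t)
    (hY : ∀ᶠ h in 𝓝[>] (0 : ℝ), M.IsStages F₁ F₂ h (q 0) (p 0) (Y h))
    (hbd : ∀ i, (fun h => (Y h).P i) =O[𝓝[>] 0] fun h : ℝ => h ^ 0)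
    (τ : AdjointApprox T (fun t => fderiv ℝ F₁ (q t)) (fun t => fderiv ℝ F₂ (q t)) m) :
    (fun h => τ.W h (M.pNext F₁ F₂ h (p 0) (Y h) - p h) - τ.V h (M.qNext h (q 0) (Y h) - q h))
      =O[𝓝[>] 0] fun h => h ^ (2 * m + 3) := by
  obtain ⟨hqs, hps⟩ := contDiffOn_of_isSolution hT (hF₁.add hF₂) hq hp
  have one : (1 : ℝ) ∈ Icc (0 : ℝ) 1 := ⟨zero_le_one, le_rfl⟩
  have hE := fun i => isBigO_momentum_error H₁ H₂ hT hF₁ hF₂ hq hp hY hbd le_rfl i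
  have hQY := hY.mono fun h hh => hh.Q_eq
  have hQtY := hY.mono fun h hh => hh.Qt_eq
  -- errors of the forces
  have f₁ := isBigO_force_error (P := fun h => (Y h).P) (Q := fun h => (Y h).Q) H₁ hT hb H₁.mem
    H₁.quad hF₁ hqs hps hq hQY
    (isBigO_position_error H₁ hT H₁.mem hps hq hQY le_rfl hE) τ.smooth_W τ.poly_g₁ τ.deriv_G₁
    τ.smooth_G₁ τ.K_nonneg τ.approx₁
  have f₂ := isBigO_force_error (P := fun h => (Y h).P) (Q := fun h => (Y h).Qt) H₂ hT hb H₁.mem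
    H₁.quad hF₂ hqs hps hq hQtY
    (isBigO_position_error H₂ hT H₁.mem hps hq hQtY le_rfl hE) τ.smooth_W τ.poly_g₂ τ.deriv_G₂
    τ.smooth_G₂ τ.K_nonneg τ.approx₂
  -- the exact solution satisfies the weak form of the equations up to quadrature errors
  have hV := τ.poly_V.contDiff
  have s₁ := τ.smooth_W.contDiffOn.clm_apply (hF₁.comp_contDiffOn hqs)
  have s₂ := τ.smooth_W.contDiffOn.clm_apply (hF₂.comp_contDiffOn hqs)
  obtain ⟨J₁, hJ₁⟩ := exists_primitive_Icc hT s₁.continuousOn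
  obtain ⟨J₂, hJ₂⟩ := exists_primitive_Icc hT s₂.continuousOn
  have r₁ := H₁.quad.isBigO hT H₁.mem one s₁ hJ₁
  have r₂ := H₂.quad.isBigO hT H₂.mem one s₂ hJ₂
  have rp := H₁.quad.isBigO hT H₁.mem one (f := fun t => τ.V t (p t))
    (G := fun t => τ.W t (p t) - J₁ t - J₂ t) (hV.contDiffOn.clm_apply hps) (fun t ht => by
      have := ((((τ.deriv_W t).hasDerivWithinAt (s := Icc 0 T)).clm_apply
        (hp t ht)).fun_sub (hJ₁ t ht)).fun_sub (hJ₂ t ht)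
      convert this using 1
      simp only [Function.comp_apply, map_add]
      abel)
  have rq := isBigO_clm_apply (isBigO_one_comp hT hV.continuous.continuousOn)
    (H₁.quad.isBigO hT H₁.mem one hps hq)
  rw [zero_add] at rq
  have e : 2 * (m + 1) + 1 = 2 * m + 3 := by ring
  rw [e] at r₁ r₂ rp rq
  -- the numerical solution satisfies the discrete weak form exactly
  have num : ∀ᶠ h in 𝓝[>] (0 : ℝ), τ.W h (M.pNext F₁ F₂ h (p 0) (Y h)) = τ.W 0 (p 0) +
      h • ∑ i, M.b i • τ.V (c i * h) ((Y h).P i) +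
      h • ∑ j, M.b j • τ.W (c j * h) (F₁ ((Y h).Q j)) +
      h • ∑ k, M.bt k • τ.W (γ k * h) (F₂ ((Y h).Qt k)) := by
    filter_upwards [hY] with h hh
    have hP : ∀ i, (Y h).P i = M.pNext F₁ F₂ h (p 0) (Y h) -
        h • (∑ j, (M.b j * M.A j i / M.b i) • F₁ ((Y h).Q j) +
          ∑ k, (M.bt k * M.At k i / M.b i) • F₂ ((Y h).Qt k)) := by
      intro i
      rw [hh.P_eq, AdditiveMethod.pNext]
      simp only [AdditiveMethod.Ahat, AdditiveMethod.Athat, Matrix.of_apply, sub_smul,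
        Finset.sum_sub_distrib, smul_sub, smul_add]
      abel
    have q₁ := sum_test_hatRow H₁ hb τ.poly_V τ.deriv_W (fun j => F₁ ((Y h).Q j)) h
    have q₂ := sum_test_hatRow H₂ hb τ.poly_V τ.deriv_W (fun k => F₂ ((Y h).Qt k)) h
    have q₃ := (H₁.quad.mono (by omega : m + 1 ≤ 2 * (m + 1))).polyLT τ.poly_V τ.deriv_W h
    have q₄ : h • ∑ i, M.b i • τ.V (c i * h) ((Y h).P i) =
        τ.W h (M.pNext F₁ F₂ h (p 0) (Y h)) - τ.W 0 (M.pNext F₁ F₂ h (p 0) (Y h)) -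
        h • (∑ j, M.b j • τ.W (c j * h) (F₁ ((Y h).Q j)) - τ.W 0 (∑ j, M.b j • F₁ ((Y h).Q j)) +
        (∑ k, M.bt k • τ.W (γ k * h) (F₂ ((Y h).Qt k)) -
          τ.W 0 (∑ k, M.bt k • F₂ ((Y h).Qt k)))) := by
      rw [← q₁, ← q₂, ← sub_apply, ← one_mul h, ← q₃, one_mul]
      have hVP : ∀ i, τ.V (c i * h) ((Y h).P i) = τ.V (c i * h) (M.pNext F₁ F₂ h (p 0) (Y h)) -
          h • (τ.V (c i * h) (∑ j, (M.b j * M.A j i / M.b i) • F₁ ((Y h).Q j)) +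
            τ.V (c i * h) (∑ k, (M.bt k * M.At k i / M.b i) • F₂ ((Y h).Qt k))) := fun i => by
        conv_lhs => rw [hP i]
        rw [map_sub, map_smul, map_add]
      simp only [hVP, smul_sub, smul_add, Finset.sum_sub_distrib, Finset.sum_add_distrib,
        Finset.smul_sum, sum_apply, smul_apply, smul_comm h (M.b _)]
    rw [q₄, AdditiveMethod.pNext]
    simp only [map_add, map_smul, smul_sub, smul_add]
    abel
  refine (((((f₁.add f₂).add r₁).add r₂).add rp).sub rq).congr' ?_ EventuallyEq.rfl
  filter_upwards [num] with h hh
  have v : h • ∑ i, M.b i • τ.V h ((Y h).P i - p (c i * h)) =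
      h • ∑ i, M.b i • τ.V (c i * h) ((Y h).P i - p (c i * h)) +
      h • ∑ i, M.b i • (τ.G₁ h - τ.G₁ (c i * h)) ((Y h).P i - p (c i * h)) +
      h • ∑ i, M.b i • (τ.G₂ h - τ.G₂ (c i * h)) ((Y h).P i - p (c i * h)) := by
    simp only [← smul_add, ← Finset.sum_add_distrib]
    congr 1
    refine Finset.sum_congr rfl fun i _ => ?_
    rw [τ.V_eq h, τ.V_eq (c i * h)]
    simp only [add_apply, sub_apply]
    congr 1
    abel
  rw [map_sub (τ.W h), hh, AdditiveMethod.qNext]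
  simp only [map_sub, map_add, map_smul, map_sum, smul_sub, Finset.sum_sub_distrib, one_mul,
    Function.comp_apply] at v ⊢
  rw [← sub_eq_zero] at v ⊢
  rw [← v]
  abel

/-- The order theorem: a symplectic pair with the simplifying assumptions has local error
`O(h ^ (2 * m + 3))`. -/
theorem isBigO_step_error (hb : ∀ i, M.b i ≠ 0) (H₁ : IsCompatible m M.b c M.b c M.A)
    (H₂ : IsCompatible m M.b c M.bt γ M.At) (hT : 0 < T)
    (hF₁ : ContDiff ℝ ∞ F₁) (hF₂ : ContDiff ℝ ∞ F₂)
    (hq : ∀ t ∈ Icc 0 T, HasDerivWithinAt q (p t) (Icc 0 T) t)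
    (hp : ∀ t ∈ Icc 0 T, HasDerivWithinAt p (F₁ (q t) + F₂ (q t)) (Icc 0 T) t)
    (hY : ∀ᶠ h in 𝓝[>] (0 : ℝ), M.IsStages F₁ F₂ h (q 0) (p 0) (Y h))
    (hbd : ∀ i, (fun h => (Y h).P i) =O[𝓝[>] 0] fun h : ℝ => h ^ 0) :
    ((fun h => M.qNext h (q 0) (Y h) - q h) =O[𝓝[>] 0] fun h => h ^ (2 * m + 3)) ∧
    ((fun h => M.pNext F₁ F₂ h (p 0) (Y h) - p h) =O[𝓝[>] 0] fun h => h ^ (2 * m + 3)) := by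
  obtain ⟨hqs, hps⟩ := contDiffOn_of_isSolution hT (hF₁.add hF₂) hq hp
  have sD : ∀ F : E → E, ContDiff ℝ ∞ F → ContDiffOn ℝ ∞ (fun t => fderiv ℝ F (q t)) (Icc 0 T) :=
    fun F hF => (contDiff_infty_iff_fderiv.1 hF).2.comp_contDiffOn hqs
  obtain ⟨τ, τW, τV⟩ := exists_adjointApprox hT (sD F₁ hF₁) (sD F₂ hF₂) 1 0 m
  obtain ⟨σ, σW, σV⟩ := exists_adjointApprox hT (sD F₁ hF₁) (sD F₂ hF₂) 0 1 m
  have R := isBigO_adjoint_error hb H₁ H₂ hT hF₁ hF₂ hq hp hY hbd τ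
  have S := isBigO_adjoint_error hb H₁ H₂ hT hF₁ hF₂ hq hp hY hbd σ
  -- near `0` the two tests separate the momentum error from the position error
  have lim : ∀ (A : ℝ → E →L[ℝ] E) (A₀ : E →L[ℝ] E), Continuous A → A 0 = A₀ →
      ∀ᶠ h in 𝓝[>] (0 : ℝ), ‖A h - A₀‖ ≤ 1 / 4 := by
    intro A A₀ hA h0
    have h1 : Tendsto A (𝓝[>] 0) (𝓝 A₀) := h0 ▸ (hA.tendsto 0).mono_left nhdsWithin_le_nhds
    filter_upwards [h1 (Metric.closedBall_mem_nhds A₀ (by norm_num : (0 : ℝ) < 1 / 4))] with h hh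
    exact mem_closedBall_iff_norm.1 hh
  have main : ∀ᶠ h in 𝓝[>] (0 : ℝ), ∀ x y : E, ‖x‖ + ‖y‖ ≤
      2 * (‖τ.W h y - τ.V h x‖ + ‖σ.W h y - σ.V h x‖) := by
    filter_upwards [lim _ _ τ.smooth_W.continuous τW, lim _ _ τ.poly_V.contDiff.continuous τV,
      lim _ _ σ.smooth_W.continuous σW, lim _ _ σ.poly_V.contDiff.continuous σV] with h a₁ a₂ a₃ a₄
    intro x y
    have b₁ := (τ.W h - 1).le_of_opNorm_le a₁ y
    have b₂ := (τ.V h - 0).le_of_opNorm_le a₂ x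
    have b₃ := (σ.W h - 0).le_of_opNorm_le a₃ y
    have b₄ := (σ.V h - 1).le_of_opNorm_le a₄ x
    have c₁ : ‖y‖ ≤ ‖τ.W h y - τ.V h x‖ + ‖(τ.W h - 1) y‖ + ‖(τ.V h - 0) x‖ := by
      have : y = (τ.W h y - τ.V h x) - (τ.W h - 1) y + (τ.V h - 0) x := by
        simp
      calc ‖y‖ = _ := congrArg norm this
        _ ≤ _ := (norm_add_le _ _).trans (add_le_add_left (norm_sub_le _ _) _)
    have c₂ : ‖x‖ ≤ ‖σ.W h y - σ.V h x‖ + ‖(σ.W h - 0) y‖ + ‖(σ.V h - 1) x‖ := by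
      have : -x = (σ.W h y - σ.V h x) - (σ.W h - 0) y + (σ.V h - 1) x := by
        simp only [sub_apply, zero_apply, one_apply_eq_self]
        abel
      calc ‖x‖ = _ := (norm_neg x).symm.trans (congrArg norm this)
        _ ≤ _ := (norm_add_le _ _).trans (add_le_add_left (norm_sub_le _ _) _)
    linarith
  have fin := (R.norm_left.add S.norm_left).const_mul_left 2
  constructor
  · refine (IsBigO.of_bound 1 ?_).trans fin
    filter_upwards [main] with h hh
    rw [one_mul]
    exact (le_add_of_nonneg_right (norm_nonneg _)).trans ((hh _ _).trans (le_abs_self _))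
  · refine (IsBigO.of_bound 1 ?_).trans fin
    filter_upwards [main] with h hh
    rw [one_mul]
    exact (le_add_of_nonneg_left (norm_nonneg _)).trans ((hh _ _).trans (le_abs_self _))

end Order

/-! ### Solvability of the stage equations -/

section Solvability

variable {E : Type*} [NormedAddCommGroup E] [NormedSpace ℝ E]

theorem norm_sum_smul_le {m n : ℕ} (A : Matrix (Fin m) (Fin n) ℝ) {v : Fin n → E} {C : ℝ}
    (hv : ∀ j, ‖v j‖ ≤ C) (hC : 0 ≤ C) (i : Fin m) :
    ‖∑ j, A i j • v j‖ ≤ (∑ i, ∑ j, |A i j|) * C := by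
  calc ‖∑ j, A i j • v j‖ ≤ ∑ j, |A i j| * C := norm_sum_le_of_le _ fun j _ => by
        rw [norm_smul, Real.norm_eq_abs]
        exact mul_le_mul_of_nonneg_left (hv j) (abs_nonneg _)
    _ = (∑ j, |A i j|) * C := (Finset.sum_mul _ _ _).symm
    _ ≤ _ := mul_le_mul_of_nonneg_right (Finset.single_le_sum (f := fun i => ∑ j, |A i j|)
        (fun i _ => Finset.sum_nonneg fun j _ => abs_nonneg _) (Finset.mem_univ i)) hC

/-- A smooth map is Lipschitz and bounded on some closed ball around a given point. -/
theorem exists_closedBall_lipschitz {F : E → E} (hF : ContDiff ℝ ∞ F) (y : E) :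
    ∃ r > 0, ∃ L B : ℝ, 0 ≤ L ∧ 0 ≤ B ∧ (∀ u ∈ Metric.closedBall y r, ‖F u‖ ≤ B) ∧
      ∀ u ∈ Metric.closedBall y r, ∀ v ∈ Metric.closedBall y r, ‖F u - F v‖ ≤ L * ‖u - v‖ := by
  obtain ⟨K, s, hs, hK⟩ := (hF.of_le (by simp) : ContDiff ℝ 1 F).contDiffAt.exists_lipschitzOnWith
    (x := y)
  obtain ⟨r, hr, hrs⟩ := Metric.nhds_basis_closedBall.mem_iff.1 hs
  refine ⟨r, hr, K, ‖F y‖ + K * r, K.2, add_nonneg (norm_nonneg _) (mul_nonneg K.2 hr.le),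
    fun u hu => ?_, fun u hu v hv => hK.norm_sub_le (hrs hu) (hrs hv)⟩
  have h1 := hK.norm_sub_le (hrs hu) (hrs (Metric.mem_closedBall_self hr.le))
  have h2 : (K : ℝ) * ‖u - y‖ ≤ K * r :=
    mul_le_mul_of_nonneg_left (mem_closedBall_iff_norm.1 hu) K.2
  have h3 := norm_le_insert' (F u) (F y)
  linarith

variable [CompleteSpace E] {s₁ s₂ : ℕ}

/-- For small step sizes the stage equations have exactly one solution with momentum stages in
a given ball around `p₀`: eliminating the position stages leaves a fixed point equation for
a contraction of this ball. -/
theorem eventually_existsUnique_isStages (M : AdditiveMethod s₁ s₂) {F₁ F₂ : E → E}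
    (hF₁ : ContDiff ℝ ∞ F₁) (hF₂ : ContDiff ℝ ∞ F₂) (q₀ p₀ : E) {ρ : ℝ} (hρ : 0 < ρ) :
    ∀ᶠ h in 𝓝[>] (0 : ℝ), ∃! Y : Stages s₁ s₂ E,
      (∀ i, ‖Y.P i - p₀‖ ≤ ρ) ∧ M.IsStages F₁ F₂ h q₀ p₀ Y := by
  obtain ⟨r₁, hr₁, L₁, B₁, hL₁, hB₁, b₁, l₁⟩ := exists_closedBall_lipschitz hF₁ q₀
  obtain ⟨r₂, hr₂, L₂, B₂, hL₂, hB₂, b₂, l₂⟩ := exists_closedBall_lipschitz hF₂ q₀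
  set a := ∑ i, ∑ j, |M.A i j|
  set a' := ∑ i, ∑ j, |M.At i j|
  set k := ∑ i, ∑ j, |M.Ahat i j|
  set k' := ∑ i, ∑ j, |M.Athat i j|
  have nk : 0 ≤ k := Finset.sum_nonneg fun i _ => Finset.sum_nonneg fun j _ => abs_nonneg _
  have nk' : 0 ≤ k' := Finset.sum_nonneg fun i _ => Finset.sum_nonneg fun j _ => abs_nonneg _
  have small : ∀ C ε : ℝ, 0 < ε → ∀ᶠ h in 𝓝[>] (0 : ℝ), h * C ≤ ε := by
    intro C ε hε
    have : Tendsto (fun h : ℝ => h * C) (𝓝[>] 0) (𝓝 0) := by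
      have hc : Continuous fun h : ℝ => h * C := by fun_prop
      simpa using (hc.tendsto 0).mono_left nhdsWithin_le_nhds
    exact (this.eventually_lt_const hε).mono fun h hh => hh.le
  filter_upwards [self_mem_nhdsWithin, Ioc_mem_nhdsGT one_pos,
    small (a * (‖p₀‖ + ρ)) r₁ hr₁, small (a' * (‖p₀‖ + ρ)) r₂ hr₂,
    small (k * B₁ + k' * B₂) ρ hρ, small (k * (L₁ * a) + k' * (L₂ * a')) (1 / 2) (by norm_num)]
    with h h0 h1 e₁ e₂ e₃ e₄
  have hpos : 0 ≤ h := le_of_lt h0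
  set Qf : (Fin s₁ → E) → Fin s₁ → E := fun P i => q₀ + h • ∑ j, M.A i j • P j with hQf
  set Qtf : (Fin s₁ → E) → Fin s₂ → E := fun P i => q₀ + h • ∑ j, M.At i j • P j with hQtf
  set Φ : (Fin s₁ → E) → Fin s₁ → E := fun P i => p₀ + h • ∑ j, M.Ahat i j • F₁ (Qf P j) +
    h • ∑ j, M.Athat i j • F₂ (Qtf P j) with hΦ
  set S : Set (Fin s₁ → E) := Metric.closedBall (fun _ => p₀) ρ with hS
  have memS : ∀ P, P ∈ S ↔ ∀ i, ‖P i - p₀‖ ≤ ρ := fun P => by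
    rw [hS, mem_closedBall_iff_norm, pi_norm_le_iff_of_nonneg hρ.le]
    rfl
  have bdS : ∀ P ∈ S, ∀ i, ‖P i‖ ≤ ‖p₀‖ + ρ := fun P hP i => by
    have h2 := norm_le_insert' (P i) p₀
    have h3 := (memS P).1 hP i
    linarith
  have Qmem : ∀ P ∈ S, ∀ i, Qf P i ∈ Metric.closedBall q₀ r₁ := fun P hP i => by
    rw [mem_closedBall_iff_norm, hQf, add_sub_cancel_left, norm_smul, Real.norm_of_nonneg hpos]
    exact (mul_le_mul_of_nonneg_left (norm_sum_smul_le M.A (bdS P hP) (by positivity) i)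
      hpos).trans e₁
  have Qtmem : ∀ P ∈ S, ∀ i, Qtf P i ∈ Metric.closedBall q₀ r₂ := fun P hP i => by
    rw [mem_closedBall_iff_norm, hQtf, add_sub_cancel_left, norm_smul, Real.norm_of_nonneg hpos]
    exact (mul_le_mul_of_nonneg_left (norm_sum_smul_le M.At (bdS P hP) (by positivity) i)
      hpos).trans e₂
  have Qlip : ∀ P P' : Fin s₁ → E, ∀ i, ‖Qf P i - Qf P' i‖ ≤ a * ‖P - P'‖ := fun P P' i => by
    have e : Qf P i - Qf P' i = h • ∑ j, M.A i j • (P - P') j := by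
      simp only [hQf, Pi.sub_apply, smul_sub, Finset.sum_sub_distrib, add_sub_add_left_eq_sub]
    rw [e, norm_smul, Real.norm_of_nonneg hpos]
    exact (mul_le_of_le_one_left (norm_nonneg _) h1.2).trans
      (norm_sum_smul_le M.A (norm_le_pi_norm (P - P')) (norm_nonneg _) i)
  have Qtlip : ∀ P P' : Fin s₁ → E, ∀ i, ‖Qtf P i - Qtf P' i‖ ≤ a' * ‖P - P'‖ := fun P P' i => by
    have e : Qtf P i - Qtf P' i = h • ∑ j, M.At i j • (P - P') j := by
      simp only [hQtf, Pi.sub_apply, smul_sub, Finset.sum_sub_distrib, add_sub_add_left_eq_sub]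
    rw [e, norm_smul, Real.norm_of_nonneg hpos]
    exact (mul_le_of_le_one_left (norm_nonneg _) h1.2).trans
      (norm_sum_smul_le M.At (norm_le_pi_norm (P - P')) (norm_nonneg _) i)
  have na : 0 ≤ a := Finset.sum_nonneg fun i _ => Finset.sum_nonneg fun j _ => abs_nonneg _
  have na' : 0 ≤ a' := Finset.sum_nonneg fun i _ => Finset.sum_nonneg fun j _ => abs_nonneg _
  have maps : MapsTo Φ S S := fun P hP => by
    rw [memS]
    intro i
    have e : Φ P i - p₀ =
        h • (∑ j, M.Ahat i j • F₁ (Qf P j) + ∑ j, M.Athat i j • F₂ (Qtf P j)) := by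
      simp only [hΦ, smul_add]
      abel
    rw [e, norm_smul, Real.norm_of_nonneg hpos]
    refine le_trans (mul_le_mul_of_nonneg_left ((norm_add_le _ _).trans (add_le_add ?_ ?_)) hpos) e₃
    · exact norm_sum_smul_le M.Ahat (fun j => b₁ _ (Qmem P hP j)) hB₁ i
    · exact norm_sum_smul_le M.Athat (fun j => b₂ _ (Qtmem P hP j)) hB₂ i
  have contr : ∀ P ∈ S, ∀ P' ∈ S, ‖Φ P - Φ P'‖ ≤ 1 / 2 * ‖P - P'‖ := fun P hP P' hP' => by
    rw [pi_norm_le_iff_of_nonneg (by positivity)]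
    intro i
    have e : (Φ P - Φ P') i = h • (∑ j, M.Ahat i j • (F₁ (Qf P j) - F₁ (Qf P' j)) +
        ∑ j, M.Athat i j • (F₂ (Qtf P j) - F₂ (Qtf P' j))) := by
      simp only [hΦ, Pi.sub_apply, smul_add, smul_sub, Finset.sum_sub_distrib]
      abel
    rw [e, norm_smul, Real.norm_of_nonneg hpos]
    have g₁ := norm_sum_smul_le M.Ahat (C := L₁ * (a * ‖P - P'‖)) (fun j => (l₁ _ (Qmem P hP j) _
      (Qmem P' hP' j)).trans (mul_le_mul_of_nonneg_left (Qlip P P' j) hL₁)) (by positivity) i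
    have g₂ := norm_sum_smul_le M.Athat (C := L₂ * (a' * ‖P - P'‖)) (fun j => (l₂ _ (Qtmem P hP j) _
      (Qtmem P' hP' j)).trans (mul_le_mul_of_nonneg_left (Qtlip P P' j) hL₂)) (by positivity) i
    calc _ ≤ h * (k * (L₁ * (a * ‖P - P'‖)) + k' * (L₂ * (a' * ‖P - P'‖))) :=
          mul_le_mul_of_nonneg_left ((norm_add_le _ _).trans (add_le_add g₁ g₂)) hpos
      _ = h * (k * (L₁ * a) + k' * (L₂ * a')) * ‖P - P'‖ := by ring
      _ ≤ _ := mul_le_mul_of_nonneg_right e₄ (norm_nonneg _)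
  -- the stage equations are the fixed point equation of `Φ`
  have hfix : ∀ Y : Stages s₁ s₂ E, M.IsStages F₁ F₂ h q₀ p₀ Y ↔
      Φ Y.P = Y.P ∧ Y.Q = Qf Y.P ∧ Y.Qt = Qtf Y.P := fun Y => by
    constructor
    · intro hY
      have hQ : Y.Q = Qf Y.P := funext hY.Q_eq
      have hQt : Y.Qt = Qtf Y.P := funext hY.Qt_eq
      exact ⟨funext fun i => by rw [hY.P_eq i, hQ, hQt], hQ, hQt⟩
    · rintro ⟨hP, hQ, hQt⟩
      exact ⟨fun i => by rw [hQ, hQt]; exact (congrFun hP i).symm, fun i => by rw [hQ],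
        fun i => by rw [hQt]⟩
  have hc : ContractingWith (1 / 2 : NNReal) (maps.restrict Φ S S) :=
    ⟨by rw [← NNReal.coe_lt_coe]; norm_num, LipschitzWith.of_dist_le_mul fun P P' => by
      have := contr P P.2 P' P'.2
      simpa [Subtype.dist_eq, dist_eq_norm] using this⟩
  obtain ⟨P, hPS, hP, -⟩ := ContractingWith.exists_fixedPoint' Metric.isClosed_closedBall.isComplete
    maps hc (Metric.mem_closedBall_self hρ.le) (edist_ne_top _ _)
  refine ⟨⟨P, Qf P, Qtf P⟩, ⟨(memS P).1 hPS, (hfix _).2 ⟨hP, rfl, rfl⟩⟩, ?_⟩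
  rintro ⟨P', Q', Qt'⟩ ⟨hP'S, hY'⟩
  obtain ⟨hP', hQ', hQt'⟩ := (hfix _).1 hY'
  have hPP : P' = P := by
    have := contr P' ((memS P').2 hP'S) P hPS
    rw [hP', hP.eq] at this
    have h2 := norm_nonneg (P' - P)
    exact sub_eq_zero.1 (norm_eq_zero.1 (by linarith))
  simp only at hQ' hQt'
  rw [hQ', hQt', hPP]

end Solvability

/-! ### From local error estimates to the order of a method -/

theorem contDiff_of_eq_neg_gradient {d : ℕ} {V : EuclideanSpace ℝ (Fin d) → ℝ}
    (hV : ContDiff ℝ ∞ V) {F : EuclideanSpace ℝ (Fin d) → EuclideanSpace ℝ (Fin d)}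
    (hF : ∀ x, F x = -gradient V x) : ContDiff ℝ ∞ F := by
  rw [funext hF]
  exact ((InnerProductSpace.toDual ℝ _).symm.toContinuousLinearEquiv.contDiff.comp
    (contDiff_infty_iff_fderiv.1 hV).2).neg

/-- An additive method both of whose families of position stages satisfy the simplifying
assumptions has order `2 * (m + 1)`. -/
theorem hasOrder_of_isCompatible {s₁ s₂ m : ℕ} {M : AdditiveMethod s₁ s₂} {c : Fin s₁ → ℝ}
    {γ : Fin s₂ → ℝ} (hb : ∀ i, M.b i ≠ 0) (H₁ : IsCompatible m M.b c M.b c M.A)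
    (H₂ : IsCompatible m M.b c M.bt γ M.At) : M.HasOrder (2 * (m + 1)) := by
  intro d V₁ V₂ hV₁ hV₂ F₁ F₂ hF₁ hF₂ T q p hT hq hp ρ hρ
  have sF₁ := contDiff_of_eq_neg_gradient hV₁ hF₁
  have sF₂ := contDiff_of_eq_neg_gradient hV₂ hF₂
  have hex := eventually_existsUnique_isStages M sF₁ sF₂ (q 0) (p 0) hρ
  classical
  -- the unique stages, as a function of the step size
  obtain ⟨Y, hY⟩ : ∃ Y : ℝ → Stages s₁ s₂ (EuclideanSpace ℝ (Fin d)), ∀ᶠ h in 𝓝[>] (0 : ℝ),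
      (∀ i, ‖(Y h).P i - p 0‖ ≤ ρ) ∧ M.IsStages F₁ F₂ h (q 0) (p 0) (Y h) := by
    refine ⟨fun h => if hh : ∃ Y : Stages s₁ s₂ (EuclideanSpace ℝ (Fin d)),
      (∀ i, ‖Y.P i - p 0‖ ≤ ρ) ∧ M.IsStages F₁ F₂ h (q 0) (p 0) Y then hh.choose
        else ⟨0, 0, 0⟩, ?_⟩
    filter_upwards [hex] with h hh
    rw [dif_pos hh.exists]
    exact hh.exists.choose_spec
  have hbd : ∀ i, (fun h => (Y h).P i) =O[𝓝[>] 0] fun h : ℝ => h ^ 0 := fun i => by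
    refine IsBigO.of_bound (‖p 0‖ + ρ) ?_
    filter_upwards [hY] with h hh
    have h1 := hh.1 i
    have h2 := norm_le_insert' ((Y h).P i) (p 0)
    simp only [pow_zero, norm_one, mul_one]
    linarith
  obtain ⟨R, S⟩ := isBigO_step_error hb H₁ H₂ hT sF₁ sF₂ hq hp (hY.mono fun h hh => hh.2) hbd
  obtain ⟨K₁, hK₁⟩ := R.bound
  obtain ⟨K₂, hK₂⟩ := S.bound
  obtain ⟨h₀, hh₀, hsub⟩ := mem_nhdsGT_iff_exists_Ioc_subset.1
    (((hex.and hY).and (hK₁.and hK₂)).and (Ioc_mem_nhdsGT hT))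
  refine ⟨min h₀ T, max K₁ K₂, lt_min hh₀ hT, min_le_right _ _, fun h hpos hle => ?_⟩
  obtain ⟨⟨⟨u, hYh⟩, k₁, k₂⟩, -⟩ := hsub ⟨hpos, hle.trans (min_le_left _ _)⟩
  refine ⟨u, fun Z hZ hZs => ?_⟩
  rw [u.unique ⟨hZ, hZs⟩ hYh]
  have hp0 : 0 ≤ h ^ (2 * (m + 1) + 1) := by positivity
  rw [show 2 * m + 3 = 2 * (m + 1) + 1 by ring, Real.norm_of_nonneg hp0] at k₁ k₂
  exact ⟨k₁.trans (mul_le_mul_of_nonneg_right (le_max_left _ _) hp0),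
    k₂.trans (mul_le_mul_of_nonneg_right (le_max_right _ _) hp0)⟩

end SymplecticARK

namespace SymplecticARK

open Set Polynomial

/-! ### The Lobatto and Legendre polynomials and their zeros -/

section Rodrigues

/-- The polynomials `d^k/dx^k (x^n (x-1)^n)`. The zeros are the Lobatto nodes for `k + 1 = n` and
the Gauss nodes for `k = n`. -/
noncomputable def rodrigues (n k : ℕ) : ℝ[X] := derivative^[k] (X ^ n * (X - 1) ^ n)

theorem rodrigues_succ (n k : ℕ) : rodrigues n (k + 1) = derivative (rodrigues n k) :=
  Function.iterate_succ_apply' _ _ _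

/-- Rodrigues' formula, up to a nonzero constant. -/
theorem map_shiftedLegendre (n : ℕ) :
    ∃ a : ℝ, a ≠ 0 ∧ rodrigues n n = C a * (shiftedLegendre n).map (Int.castRingHom ℝ) := by
  have h := congrArg (Polynomial.map (Int.castRingHom ℝ)) (factorial_mul_shiftedLegendre_eq n)
  rw [← iterate_derivative_map] at h
  simp only [Polynomial.map_mul, Polynomial.map_natCast, Polynomial.map_pow, map_X,
    Polynomial.map_sub, Polynomial.map_one] at h
  refine ⟨(-1) ^ n * n.factorial, by positivity, ?_⟩
  have e : (X : ℝ[X]) ^ n * (X - 1) ^ n = C ((-1) ^ n) * (X ^ n * (1 - X) ^ n) := by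
    rw [← neg_sub (1 : ℝ[X]) X, neg_pow (1 - X : ℝ[X])]
    simp only [map_pow, map_neg, map_one]
    ring
  rw [rodrigues, e, iterate_derivative_C_mul, ← h, C_mul, C_eq_natCast, mul_assoc]

theorem rodrigues_ne_zero {n k : ℕ} (hk : k ≤ n) : rodrigues n k ≠ 0 := by
  intro h
  have h1 : rodrigues n n = derivative^[n - k] (rodrigues n k) := by
    rw [rodrigues, rodrigues, ← Function.iterate_add_apply, Nat.sub_add_cancel hk]
  rw [h, iterate_derivative_zero] at h1
  obtain ⟨a, ha, e⟩ := map_shiftedLegendre n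
  rw [h1] at e
  have h2 : shiftedLegendre n = 0 := by
    refine (Polynomial.map_eq_zero_iff (Int.castRingHom ℝ).injective_int).1 ?_
    simpa [ha] using e.symm
  have h3 := degree_shiftedLegendre n
  simp [h2] at h3

theorem natDegree_rodrigues_le (n k : ℕ) : (rodrigues n k).natDegree ≤ 2 * n - k := by
  refine (natDegree_iterate_derivative _ _).trans (Nat.sub_le_sub_right ?_ _)
  refine natDegree_mul_le.trans ?_
  rw [natDegree_X_pow, natDegree_pow, ← C_1, natDegree_X_sub_C]
  omega

theorem eval_rodrigues_endpoints {n k : ℕ} (hk : k < n) :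
    (rodrigues n k).eval 0 = 0 ∧ (rodrigues n k).eval 1 = 0 := by
  have hn : n - k ≠ 0 := by omega
  constructor
  · have h := pow_sub_dvd_iterate_derivative_of_pow_dvd k
      (Dvd.intro _ rfl : (X : ℝ[X]) ^ n ∣ X ^ n * (X - 1) ^ n)
    obtain ⟨g, hg⟩ := h
    simp [rodrigues, hg, hn]
  · have h := pow_sub_dvd_iterate_derivative_of_pow_dvd k
      (Dvd.intro_left _ rfl : (X - 1 : ℝ[X]) ^ n ∣ X ^ n * (X - 1) ^ n)
    obtain ⟨g, hg⟩ := h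
    simp [rodrigues, hg, hn]

/-- The distinct zeros of a polynomial in the unit interval. -/
noncomputable def unitRoots (p : ℝ[X]) : Finset ℝ := {x ∈ p.roots.toFinset | x ∈ Icc (0 : ℝ) 1}

theorem mem_unitRoots {p : ℝ[X]} (hp : p ≠ 0) {x : ℝ} :
    x ∈ unitRoots p ↔ p.eval x = 0 ∧ x ∈ Icc (0 : ℝ) 1 := by
  rw [unitRoots, Finset.mem_filter, Multiset.mem_toFinset, mem_roots hp, IsRoot.def]

/-- Rolle's theorem in the unit interval. -/
theorem card_unitRoots_le {p : ℝ[X]} (hp : p ≠ 0) (hp' : derivative p ≠ 0) :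
    (unitRoots p).card ≤ (unitRoots (derivative p) \ unitRoots p).card + 1 := by
  refine Finset.card_le_sdiff_of_interleaved fun x hx y hy hxy _ => ?_
  rw [mem_unitRoots hp] at hx hy
  obtain ⟨z, hz1, hz2⟩ := exists_deriv_eq_zero hxy p.continuousOn (hx.1.trans hy.1.symm)
  refine ⟨z, (mem_unitRoots hp').2 ⟨by rwa [← p.deriv], hx.2.1.trans hz1.1.le,
    hz1.2.le.trans hy.2.2⟩, hz1⟩

/-- The two end points and, by repeated use of Rolle's theorem, `k` interior points are zeros. -/
theorem card_unitRoots_rodrigues {n k : ℕ} (hk : k < n) :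
    k + 2 ≤ (unitRoots (rodrigues n k)).card := by
  have ends : ∀ k < n, {0, 1} ⊆ unitRoots (rodrigues n k) := fun k hk x hx => by
    obtain ⟨h0, h1⟩ := eval_rodrigues_endpoints hk
    rw [mem_unitRoots (rodrigues_ne_zero hk.le)]
    rcases Finset.mem_insert.1 hx with rfl | hx
    · exact ⟨h0, by simp⟩
    · rw [Finset.mem_singleton.1 hx]
      exact ⟨h1, by simp⟩
  induction k with
  | zero => simpa using Finset.card_le_card (ends 0 hk)
  | succ k ih =>
    have h1 := ih (by omega)
    have h2 := card_unitRoots_le (rodrigues_ne_zero (by omega : k ≤ n))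
      (rodrigues_succ n k ▸ rodrigues_ne_zero hk.le)
    rw [← rodrigues_succ] at h2
    -- the end points are zeros of both polynomials, so they are not among the new zeros
    have h3 : (unitRoots (rodrigues n (k + 1)) \ unitRoots (rodrigues n k)).card + 2 ≤
        (unitRoots (rodrigues n (k + 1))).card := by
      rw [show 2 = ({0, 1} : Finset ℝ).card by simp, ← Finset.card_union_of_disjoint]
      · exact Finset.card_le_card (Finset.union_subset Finset.sdiff_subset (ends _ hk))
      · exact Finset.sdiff_disjoint.mono_right (ends k (by omega))
    omega

theorem card_unitRoots_rodrigues_self {n : ℕ} (hn : 0 < n) :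
    n ≤ (unitRoots (rodrigues n n)).card := by
  obtain ⟨k, rfl⟩ : ∃ k, n = k + 1 := ⟨n - 1, by omega⟩
  have h1 := card_unitRoots_rodrigues (by omega : k < k + 1)
  have h2 := card_unitRoots_le (rodrigues_ne_zero (by omega : k ≤ k + 1))
    (rodrigues_succ (k + 1) k ▸ rodrigues_ne_zero le_rfl)
  rw [← rodrigues_succ] at h2
  have h3 := Finset.card_le_card (Finset.sdiff_subset (s := unitRoots (rodrigues (k + 1) (k + 1)))
    (t := unitRoots (rodrigues (k + 1) k)))
  omega

/-- A polynomial of degree at most `N` with at least `N` distinct zeros in the unit interval has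
degree `N`, and `sortedRoot` enumerates its zeros without ever taking its default value. -/
theorem sortedRoot_spec {p : ℝ[X]} {N : ℕ} (hp : p ≠ 0) (hd : p.natDegree ≤ N)
    (hN : N ≤ (unitRoots p).card) :
    p.natDegree = N ∧ Function.Injective (fun i : Fin N => sortedRoot p i) ∧
      (∀ i : Fin N, p.eval (sortedRoot p i) = 0 ∧ sortedRoot p i ∈ Icc (0 : ℝ) 1) ∧
      ∀ x, p.eval x = 0 → ∃ i : Fin N, sortedRoot p i = x := by
  have h1 : (unitRoots p).card ≤ p.roots.toFinset.card :=
    Finset.card_le_card (Finset.filter_subset _ _)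
  have h2 : p.roots.toFinset.card ≤ p.natDegree :=
    (Multiset.toFinset_card_le _).trans (card_roots' p)
  have hS : unitRoots p = p.roots.toFinset :=
    Finset.eq_of_subset_of_card_le (Finset.filter_subset _ _) (by omega)
  have hlen : (p.roots.toFinset.sort).length = N := by
    rw [Finset.length_sort]
    omega
  have hget : ∀ i : Fin N, sortedRoot p i = (p.roots.toFinset.sort)[i.1]'(by omega) := fun i => by
    rw [sortedRoot, List.getD_eq_getElem]
  refine ⟨by omega, fun i j hij => ?_, fun i => ?_, fun x hx => ?_⟩
  · simp only [hget] at hij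
    exact Fin.ext ((Finset.sort_nodup _ _).getElem_inj_iff.1 hij)
  · rw [← mem_unitRoots hp, hS, hget, ← Finset.mem_sort (· ≤ ·)]
    exact List.getElem_mem _
  · have hm : x ∈ p.roots.toFinset.sort := by
      rw [Finset.mem_sort, Multiset.mem_toFinset, mem_roots hp]
      exact hx
    obtain ⟨i, hi, e⟩ := List.getElem_of_mem hm
    exact ⟨⟨i, by omega⟩, by rw [hget]; exact e⟩

end Rodrigues

/-! ### Exactness of the Lobatto and Gauss quadratures -/

section Integral

theorem intervalIntegrable_eval (p : ℝ[X]) (x y : ℝ) :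
    IntervalIntegrable (fun t => p.eval t) MeasureTheory.volume x y :=
  p.continuous.intervalIntegrable _ _

theorem integral_eval_derivative (p : ℝ[X]) (x : ℝ) :
    ∫ t in (0 : ℝ)..x, (derivative p).eval t = p.eval x - p.eval 0 :=
  intervalIntegral.integral_eq_sub_of_hasDerivAt (fun t _ => p.hasDerivAt t)
    (intervalIntegrable_eval _ _ _)

theorem exists_derivative_eq (p : ℝ[X]) :
    ∃ U : ℝ[X], derivative U = p ∧ U.eval 0 = 0 ∧
      ∀ N : ℕ, p.degree < N → U.degree < (N + 1 : ℕ) := by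
  refine ⟨∑ k ∈ Finset.range (p.natDegree + 1), C (p.coeff k / ((k : ℝ) + 1)) * X ^ (k + 1), ?_, ?_,
    fun N hN => ?_⟩
  · conv_rhs => rw [p.as_sum_range_C_mul_X_pow]
    rw [derivative_sum]
    refine Finset.sum_congr rfl fun k _ => ?_
    have hk : (k : ℝ) + 1 ≠ 0 := by positivity
    rw [derivative_C_mul_X_pow]
    simp [hk]
  · simp [eval_finsetSum]
  · refine (degree_sum_le _ _).trans_lt ((Finset.sup_lt_iff (WithBot.bot_lt_coe _)).2 fun k _ => ?_)
    by_cases hk : N ≤ k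
    · rw [coeff_eq_zero_of_degree_lt (hN.trans_le (by exact_mod_cast hk))]
      simp
    · refine (degree_C_mul_X_pow_le _ _).trans_lt ?_
      exact_mod_cast (by omega : k + 1 < N + 1)

/-- Rodrigues polynomials are orthogonal to polynomials of low degree. -/
theorem integral_rodrigues_mul {n k : ℕ} (hk : k ≤ n) (g : ℝ[X]) (hg : g.degree < k) :
    ∫ t in (0 : ℝ)..1, (rodrigues n k * g).eval t = 0 := by
  induction k generalizing g with
  | zero =>
    have : g = 0 := by simpa [Nat.WithBot.lt_zero_iff] using hg
    simp [this]
  | succ k ih =>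
    obtain ⟨h0, h1⟩ := eval_rodrigues_endpoints (by omega : k < n)
    have e : rodrigues n (k + 1) * g = derivative (rodrigues n k * g) -
        rodrigues n k * derivative g := by
      rw [derivative_mul, rodrigues_succ]
      ring
    have hg' : (derivative g).degree < k := by
      by_cases h : g = 0
      · simp [h]
      · rw [degree_eq_natDegree h] at hg
        have hg2 : g.natDegree < k + 1 := by exact_mod_cast hg
        refine (degree_derivative_lt h).trans_le ?_
        rw [degree_eq_natDegree h]
        exact_mod_cast (by omega : g.natDegree ≤ k)
    simp only [e, eval_sub]
    rw [intervalIntegral.integral_sub (intervalIntegrable_eval _ _ _)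
      (intervalIntegrable_eval _ _ _), integral_eval_derivative, ih (by omega) _ hg']
    simp [h0, h1]

/-- The quadrature formula with weights `β` and nodes `γ` integrates polynomials of degree less
than `N` exactly over the unit interval. -/
def IntegratesDegreeLT {ι : Type*} [Fintype ι] (N : ℕ) (β γ : ι → ℝ) : Prop :=
  ∀ f : ℝ[X], f.degree < N → ∑ i, β i * f.eval (γ i) = ∫ t in (0 : ℝ)..1, f.eval t

theorem IntegratesDegreeLT.isExact {ι : Type*} [Fintype ι] {N : ℕ} {β γ : ι → ℝ}
    (h : IntegratesDegreeLT N β γ) : IsExact N β γ 1 := fun k hk => by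
  have := h (X ^ k) (by rw [degree_X_pow]; exact_mod_cast hk)
  simpa using this

variable {N : ℕ} {c : Fin N → ℝ}

theorem eval_eq_sum_cardinal (hc : Function.Injective c) {f : ℝ[X]} (hf : f.degree < N) (x : ℝ) :
    f.eval x = ∑ j, f.eval (c j) * (cardinal c j).eval x := by
  have h := Lagrange.eq_interpolate (s := Finset.univ) (v := c) (f := f) hc.injOn
    (by simpa using hf)
  conv_lhs => rw [h, Lagrange.interpolate_apply, eval_finsetSum]
  simp [cardinal]

theorem integral_eq_sum_cardinal (hc : Function.Injective c) {f : ℝ[X]} (hf : f.degree < N)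
    (x : ℝ) : ∫ t in (0 : ℝ)..x, f.eval t =
      ∑ j, (∫ t in (0 : ℝ)..x, (cardinal c j).eval t) * f.eval (c j) := by
  rw [intervalIntegral.integral_congr fun t _ => eval_eq_sum_cardinal hc hf t,
    intervalIntegral.integral_finsetSum fun j _ => (intervalIntegrable_eval _ _ _).const_mul _]
  refine Finset.sum_congr rfl fun j _ => ?_
  rw [intervalIntegral.integral_const_mul, mul_comm]

/-- An interpolatory quadrature whose nodes are the zeros of `p` gains one degree of exactness for
each degree of orthogonality of `p`: divide by `p` with remainder. -/
theorem integratesDegreeLT_of_orthogonal (hc : Function.Injective c) {p : ℝ[X]} (hp : p ≠ 0)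
    (hd : p.natDegree = N) (hpc : ∀ i, p.eval (c i) = 0) {r : ℕ}
    (ho : ∀ g : ℝ[X], g.degree < r → ∫ t in (0 : ℝ)..1, (p * g).eval t = 0) :
    IntegratesDegreeLT (N + r) (interpolatoryWeights c) c := by
  intro f hf
  have hdp : p.degree = N := by rw [degree_eq_natDegree hp, hd]
  have hdiv : (f / p).degree < r := by
    by_cases h : f / p = 0
    · simp [h]
    · have hle : p.degree ≤ f.degree := not_lt.1 fun hlt =>
        h ((Polynomial.div_eq_zero_iff hp).2 hlt)
      rw [← degree_add_div hp hle, hdp, degree_eq_natDegree h] at hf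
      rw [degree_eq_natDegree h]
      have : N + (f / p).natDegree < N + r := by exact_mod_cast hf
      exact_mod_cast (by omega : (f / p).natDegree < r)
  have hmod : (f % p).degree < N := hdp ▸ EuclideanDomain.mod_lt f hp
  have e : ∀ x, f.eval x = (p * (f / p)).eval x + (f % p).eval x := fun x => by
    rw [← eval_add, EuclideanDomain.div_add_mod]
  have ec : ∀ i, f.eval (c i) = (f % p).eval (c i) := fun i => by
    rw [e, eval_mul, hpc, zero_mul, zero_add]
  simp only [ec]
  simp only [e]
  rw [intervalIntegral.integral_add (intervalIntegrable_eval _ _ _)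
    (intervalIntegrable_eval _ _ _), ho _ hdiv, zero_add, integral_eq_sum_cardinal hc hmod]
  rfl

end Integral

/-! ### Simplifying assumptions for the Lobatto--Gauss pairs -/

section Tableau

variable {m : ℕ} {c b : Fin (m + 2) → ℝ}

/-- The weights of a Lobatto-type quadrature do not vanish. If `b j = 0`, then the quadrature rule
annihilates `(X - ε) * ∏ (X - c k) ^ 2`, where `ε` is an end point among the nodes other than
`c j`; but this polynomial has constant sign on the unit interval. -/
theorem weights_ne_zero (hc : Function.Injective c) (hB : IntegratesDegreeLT (2 * (m + 1)) b c)
    (h0 : ∃ i, c i = 0) (h1 : ∃ i, c i = 1) (hmem : ∀ i, c i ∈ Icc (0 : ℝ) 1)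
    (j : Fin (m + 2)) : b j ≠ 0 := by
  intro hbj
  -- the sign `σ` makes `σ * (x - c e)` nonnegative on the unit interval
  obtain ⟨e, σ, hej, hσ⟩ : ∃ (e : Fin (m + 2)) (σ : ℝ), e ≠ j ∧
      ∀ x ∈ Icc (0 : ℝ) 1, 0 ≤ σ * (x - c e) ∧ (x ≠ c e → 0 < σ * (x - c e)) := by
    obtain ⟨e₀, he₀⟩ := h0
    obtain ⟨e₁, he₁⟩ := h1
    by_cases h : e₀ = j
    · refine ⟨e₁, -1, fun h' => ?_, fun x hx => ?_⟩
      · rw [h', ← h, he₀] at he₁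
        exact zero_ne_one he₁
      · rw [he₁]
        exact ⟨by linarith [hx.2], fun hne => by linarith [lt_of_le_of_ne hx.2 hne]⟩
    · refine ⟨e₀, 1, h, fun x hx => ?_⟩
      rw [he₀]
      exact ⟨by linarith [hx.1], fun hne => by linarith [lt_of_le_of_ne hx.1 hne.symm]⟩
  set r : ℝ[X] := ∏ k ∈ (Finset.univ.erase j).erase e, (X - C (c k)) with hr
  set f : ℝ[X] := (X - C (c e)) * r ^ 2 with hf
  have hrd : r.natDegree = m := by
    rw [hr, natDegree_prod_of_monic _ _ fun k _ => monic_X_sub_C _]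
    simp [Finset.card_erase_of_mem, hej]
  have hfd : f.degree < (2 * (m + 1) : ℕ) := by
    refine degree_le_natDegree.trans_lt ?_
    have : f.natDegree ≤ 2 * m + 1 := by
      refine natDegree_mul_le.trans ?_
      rw [natDegree_X_sub_C, natDegree_pow, hrd]
      omega
    exact_mod_cast (by omega : f.natDegree < 2 * (m + 1))
  have hzero : ∀ k, b k * f.eval (c k) = 0 := fun k => by
    by_cases hkj : k = j
    · rw [hkj, hbj, zero_mul]
    · by_cases hke : k = e
      · simp [hf, hke]
      · have : r.eval (c k) = 0 := by
          rw [hr, eval_prod]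
          exact Finset.prod_eq_zero (i := k) (by simp [hkj, hke]) (by simp)
        simp [hf, this]
  have hI : ∫ t in (0 : ℝ)..1, σ * f.eval t = 0 := by
    rw [intervalIntegral.integral_const_mul, ← hB f hfd, Finset.sum_eq_zero fun k _ => hzero k,
      mul_zero]
  have hev : ∀ x, σ * f.eval x = σ * (x - c e) * r.eval x ^ 2 := fun x => by
    simp [hf, mul_assoc]
  refine (intervalIntegral.integral_pos (f := fun t => σ * f.eval t) zero_lt_one
    (f.continuous.const_smul σ).continuousOn (fun x hx => ?_) ⟨c j, hmem j, ?_⟩).ne' hI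
  · rw [hev]
    exact mul_nonneg (hσ x ⟨hx.1.le, hx.2⟩).1 (sq_nonneg _)
  · rw [hev]
    refine mul_pos ((hσ _ (hmem j)).2 fun h => hej (hc h).symm) (sq_pos_iff.2 ?_)
    rw [hr, eval_prod]
    refine Finset.prod_ne_zero_iff.2 fun k hk => ?_
    rw [eval_sub, eval_X, eval_C, sub_ne_zero]
    exact fun h => Finset.ne_of_mem_erase (Finset.mem_of_mem_erase hk) (hc h).symm

variable {ι : Type*} [Fintype ι] {β γ : ι → ℝ}

/-- The transposed simplifying assumption implies the quadrature condition for the symplectic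
partner. -/
theorem isCompatible_of_transposed {α : ι → Fin (m + 2) → ℝ} (hb : ∀ i, b i ≠ 0)
    (hγ : ∀ x, γ x ∈ Icc (0 : ℝ) 1) (hβ : IntegratesDegreeLT (2 * (m + 1)) β γ)
    (hrow : ∀ x, IsExact (m + 1) (α x) c (γ x))
    (ht : ∀ i, ∀ k < m, ∑ x, β x * γ x ^ k * α x i = b i * ((1 - c i ^ (k + 1)) / ((k : ℝ) + 1))) :
    IsCompatible m b c β γ α where
  mem := hγ
  quad := hβ.isExact
  row := hrow
  hatRow i k hk := by
    have h1 := hβ.isExact k (by omega)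
    have h2 := ht i k hk
    calc ∑ x, (β x - β x * α x i / b i) * γ x ^ k
        = ∑ x, β x * γ x ^ k - (∑ x, β x * γ x ^ k * α x i) / b i := by
          rw [Finset.sum_div, ← Finset.sum_sub_distrib]
          exact Finset.sum_congr rfl fun x _ => by ring
      _ = c i ^ (k + 1) / ((k : ℝ) + 1) := by
          rw [h1, h2, mul_div_cancel_left₀ _ (hb i), one_pow]
          ring

theorem degree_cardinal (hc : Function.Injective c) (i : Fin (m + 2)) :
    (cardinal c i).degree = (m + 1 : ℕ) := by
  rw [cardinal, Lagrange.degree_basis hc.injOn (Finset.mem_univ i)]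
  simp

theorem sum_mul_cardinal (hc : Function.Injective c) (v : Fin (m + 2) → ℝ) (i : Fin (m + 2)) :
    ∑ j, v j * (cardinal c i).eval (c j) = v i := by
  rw [Finset.sum_eq_single i]
  · rw [cardinal, Lagrange.eval_basis_self hc.injOn (Finset.mem_univ i), mul_one]
  · intro j _ hji
    rw [cardinal, Lagrange.eval_basis_of_ne hji.symm (Finset.mem_univ j), mul_zero]
  · simp

theorem integral_X_pow_mul_cardinal (hc : Function.Injective c)
    (hB : IntegratesDegreeLT (2 * (m + 1)) b c) {k : ℕ} (hk : k ≤ m) (i : Fin (m + 2)) :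
    ∫ t in (0 : ℝ)..1, (X ^ k * cardinal c i).eval t = b i * c i ^ k := by
  rw [← hB]
  · simp only [eval_mul, eval_pow, eval_X, ← mul_assoc]
    exact sum_mul_cardinal hc (fun j => b j * c j ^ k) i
  · rw [degree_mul, degree_X_pow, degree_cardinal hc]
    exact_mod_cast (by omega : k + (m + 1) < 2 * (m + 1))

theorem collocationMatrix_row {s : ℕ} (hc : Function.Injective c) (x : Fin s → ℝ) (i : Fin s) :
    IsExact (m + 2) (collocationMatrix c x i) c (x i) := fun k hk => by
  have h := integral_eq_sum_cardinal hc (f := X ^ k)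
    (by rw [degree_X_pow]; exact_mod_cast hk) (x i)
  simp only [eval_pow, eval_X, integral_pow] at h
  simp only [collocationMatrix, Matrix.of_apply]
  rw [← h]
  simp

theorem collocationMatrix_transposed {s : ℕ} {x β : Fin s → ℝ} (hc : Function.Injective c)
    (hB : IntegratesDegreeLT (2 * (m + 1)) b c) (hβ : IntegratesDegreeLT (2 * (m + 1)) β x)
    (i : Fin (m + 2)) {k : ℕ} (hk : k < m) :
    ∑ l, β l * x l ^ k * collocationMatrix c x l i =
      b i * ((1 - c i ^ (k + 1)) / ((k : ℝ) + 1)) := by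
  obtain ⟨U, hU, hU0, hUd⟩ := exists_derivative_eq (cardinal c i)
  have hdeg : U.degree < (m + 3 : ℕ) := hUd (m + 2) (by
    rw [degree_cardinal hc]
    exact_mod_cast Nat.lt_succ_self _)
  have e1 : ∀ l, collocationMatrix c x l i = U.eval (x l) := fun l => by
    rw [collocationMatrix, Matrix.of_apply, ← hU, integral_eval_derivative, hU0, sub_zero]
  have hd : (X ^ k * U).degree < ((2 * (m + 1) : ℕ) : WithBot ℕ) := by
    by_cases h : U = 0
    · simp only [h, mul_zero, degree_zero]
      exact WithBot.bot_lt_coe _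
    · rw [degree_eq_natDegree h] at hdeg
      rw [degree_mul, degree_X_pow, degree_eq_natDegree h]
      have : U.natDegree < m + 3 := by exact_mod_cast hdeg
      exact_mod_cast (by omega : k + U.natDegree < 2 * (m + 1))
  have hU1 : U.eval 1 = b i := by
    have h1 := integral_X_pow_mul_cardinal hc hB (Nat.zero_le m) i
    rw [pow_zero, one_mul, pow_zero, mul_one, ← hU, integral_eval_derivative, hU0, sub_zero] at h1
    exact h1
  -- integration by parts
  have h2 : ∫ t in (0 : ℝ)..1, (derivative (X ^ (k + 1) * U)).eval t = b i := by
    rw [integral_eval_derivative]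
    simp [hU1]
  have h3 : derivative (X ^ (k + 1) * U) =
      C ((k : ℝ) + 1) * (X ^ k * U) + X ^ (k + 1) * cardinal c i := by
    rw [derivative_mul, derivative_X_pow, hU]
    simp [mul_assoc]
  rw [h3] at h2
  simp only [eval_add (p := C ((k : ℝ) + 1) * (X ^ k * U))] at h2
  rw [intervalIntegral.integral_add (intervalIntegrable_eval _ _ _)
    (intervalIntegrable_eval _ _ _), integral_X_pow_mul_cardinal hc hB (by omega)] at h2
  simp only [eval_mul (p := C ((k : ℝ) + 1)), eval_C] at h2
  rw [intervalIntegral.integral_const_mul, ← hβ _ hd] at h2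
  have hk : (k : ℝ) + 1 ≠ 0 := by positivity
  simp only [e1]
  rw [mul_div_assoc', eq_div_iff hk]
  simp only [eval_mul, eval_pow, eval_X, ← mul_assoc] at h2
  linarith

/-- The collocation method on the Lobatto nodes, evaluated at the nodes of a further quadrature. -/
theorem isCompatible_collocation {s : ℕ} {x β : Fin s → ℝ} (hc : Function.Injective c)
    (hb : ∀ i, b i ≠ 0) (hB : IntegratesDegreeLT (2 * (m + 1)) b c)
    (hx : ∀ l, x l ∈ Icc (0 : ℝ) 1) (hβ : IntegratesDegreeLT (2 * (m + 1)) β x) :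
    IsCompatible m b c β x (collocationMatrix c x) :=
  isCompatible_of_transposed hb hx hβ
    (fun l => (collocationMatrix_row hc x l).mono (by omega))
    fun i _ hk => collocationMatrix_transposed hc hB hβ i hk

/-- Interpolating the positions of the collocation method preserves the simplifying
assumptions. -/
theorem isCompatible_interpolation {s : ℕ} {x β : Fin s → ℝ} (hc : Function.Injective c)
    (hb : ∀ i, b i ≠ 0) (hB : IntegratesDegreeLT (2 * (m + 1)) b c)
    (hx : ∀ l, x l ∈ Icc (0 : ℝ) 1) (hβ : IntegratesDegreeLT (2 * (m + 1)) β x) :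
    IsCompatible m b c β x
      ((Matrix.of fun i l => (cardinal c l).eval (x i)) * collocationMatrix c c) := by
  refine isCompatible_of_transposed hb hx hβ (fun i k hk => ?_) fun i k hk => ?_
  · simp only [Matrix.mul_apply, Matrix.of_apply, Finset.sum_mul]
    rw [Finset.sum_comm]
    simp only [mul_assoc, ← Finset.mul_sum]
    simp only [collocationMatrix_row hc c _ k (by omega : k < m + 2)]
    have h := eval_eq_sum_cardinal hc (f := X ^ (k + 1))
      (by rw [degree_X_pow]; exact_mod_cast (by omega : k + 1 < m + 2)) (x i)
    simp only [eval_pow, eval_X] at h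
    rw [h, Finset.sum_div]
    exact Finset.sum_congr rfl fun l _ => by ring
  · simp only [Matrix.mul_apply, Matrix.of_apply, Finset.mul_sum]
    rw [Finset.sum_comm, ← collocationMatrix_transposed hc hB hB i hk]
    refine Finset.sum_congr rfl fun l _ => ?_
    rw [← integral_X_pow_mul_cardinal hc hB hk.le l, ← hβ, Finset.sum_mul]
    · exact Finset.sum_congr rfl fun j _ => by simp [mul_assoc]
    · rw [degree_mul, degree_X_pow, degree_cardinal hc]
      exact_mod_cast (by omega : k + (m + 1) < 2 * (m + 1))

end Tableau

theorem lobattoNodes_spec (m : ℕ) :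
    Function.Injective (lobattoNodes (m + 2)) ∧ (∀ i, lobattoNodes (m + 2) i ∈ Icc (0 : ℝ) 1) ∧
      (∃ i, lobattoNodes (m + 2) i = 0) ∧ (∃ i, lobattoNodes (m + 2) i = 1) ∧
      IntegratesDegreeLT (2 * (m + 1)) (interpolatoryWeights (lobattoNodes (m + 2)))
        (lobattoNodes (m + 2)) := by
  have hp : rodrigues (m + 1) m ≠ 0 := rodrigues_ne_zero (by omega)
  obtain ⟨hd, hinj, hz, hall⟩ := sortedRoot_spec hp
    ((natDegree_rodrigues_le _ _).trans (by omega : _ ≤ m + 2))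
    (card_unitRoots_rodrigues (Nat.lt_succ_self m))
  obtain ⟨h0, h1⟩ := eval_rodrigues_endpoints (Nat.lt_succ_self m)
  refine ⟨hinj, fun i => (hz i).2, hall 0 h0, hall 1 h1, ?_⟩
  have := integratesDegreeLT_of_orthogonal (c := lobattoNodes (m + 2)) hinj hp hd
    (fun i => (hz i).1) (fun g hg => integral_rodrigues_mul (by omega) g hg)
  rwa [show m + 2 + m = 2 * (m + 1) by ring] at this

theorem gaussNodes_spec (m : ℕ) :
    (∀ i, gaussNodes (m + 1) i ∈ Icc (0 : ℝ) 1) ∧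
      IntegratesDegreeLT (2 * (m + 1)) (interpolatoryWeights (gaussNodes (m + 1)))
        (gaussNodes (m + 1)) := by
  have hp : rodrigues (m + 1) (m + 1) ≠ 0 := rodrigues_ne_zero le_rfl
  obtain ⟨hd, hinj, hz, -⟩ := sortedRoot_spec hp
    ((natDegree_rodrigues_le _ _).trans (by omega : _ ≤ m + 1))
    (card_unitRoots_rodrigues_self (by omega))
  have hnodes : ∀ i : Fin (m + 1),
      sortedRoot (rodrigues (m + 1) (m + 1)) i = gaussNodes (m + 1) i := fun i => by
    obtain ⟨a, ha, e⟩ := map_shiftedLegendre (m + 1)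
    rw [gaussNodes, sortedRoot, sortedRoot, e, roots_C_mul _ ha]
  simp only [hnodes] at hinj hz
  refine ⟨fun i => (hz i).2, ?_⟩
  have := integratesDegreeLT_of_orthogonal (c := gaussNodes (m + 1)) hinj hp hd
    (fun i => (hz i).1) (fun g hg => integral_rodrigues_mul le_rfl g hg)
  rwa [show m + 1 + (m + 1) = 2 * (m + 1) by ring] at this

end SymplecticARK

theorem mainTheorem3 (s₁ : ℕ) (hs₁ : 2 ≤ s₁) :
    (SymplecticARK.interpolationMethod (SymplecticARK.lobattoIIIA s₁)
      (SymplecticARK.gaussLegendre (s₁ - 1))).HasOrder (2 * (s₁ - 1)) ∧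
    (SymplecticARK.collocationMethod (SymplecticARK.lobattoIIIA s₁)
      (SymplecticARK.gaussLegendre (s₁ - 1))).HasOrder (2 * (s₁ - 1)) := by
  obtain ⟨m, rfl⟩ : ∃ m, s₁ = m + 2 := ⟨s₁ - 2, by omega⟩
  obtain ⟨hinj, hmem, h0, h1, hB⟩ := SymplecticARK.lobattoNodes_spec m
  obtain ⟨gmem, gB⟩ := SymplecticARK.gaussNodes_spec m
  have hb := SymplecticARK.weights_ne_zero hinj hB h0 h1 hmem
  have hL := SymplecticARK.isCompatible_collocation hinj hb hB hmem hB
  exact ⟨SymplecticARK.hasOrder_of_isCompatible hb hL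
      (SymplecticARK.isCompatible_interpolation hinj hb hB gmem gB),
    SymplecticARK.hasOrder_of_isCompatible hb hL
      (SymplecticARK.isCompatible_collocation hinj hb hB gmem gB)⟩
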